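/- Let $K>0$, let $\mathcal T=\mathbb R/2\pi\mathbb Z$, and let $(f(t))_{t\ge 0}$ be a solution of the kinetic Kuramoto model for non-identical oscillators, i.e. a family of probability measures on $\mathcal T\times\mathbb R$ (phase $\vartheta$, natural frequency $\omega$), with $f_0=f(0)$, for which there are characteristics $\Theta(t,\vartheta,\omega)\in\mathcal T$ and order parameters $R(t)\ge 0$, $\varphi(t)\in\mathbb R$ such that, for all $t\ge 0$, $$\dot\Theta(t,\vartheta,\omega)=\omega-KR(t)\sin(\Theta(t,\vartheta,\omega)-\varphi(t)),\qquad \Theta(0,\vartheta,\omega)=\vartheta,$$ $$R(t)e^{i\varphi(t)}=\int_{\mathcal T\times\mathbb R}e^{i\vartheta}\,f(t,d\vartheta,d\omega),$$ $$\int_{\mathcal T\times\mathbb R} h(\vartheta,\omega)\,f(t,d\vartheta,d\omega)=\int_{\mathcal T\times\mathbb R} h(\Theta(t,\vartheta,\omega),\omega)\,f_0(d\vartheta,d\omega)$$ for every bounded continuous $h:\mathcal T\times\mathbb R\to\mathbb R$. Let $g$ be the distribution of the natural frequencies, i.e. the $\omega$-marginal of $f_0$, and suppose that for $g$-almost every $\omega$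 the conditional distribution $f_0(d\vartheta\mid\omega)$ of the phase given the frequency $\omega$ is non-atomic (gives mass zero to every point). If, as $t\to+\infty$, $R(t)\to R^*$ with $R^*>0$ and $\operatorname{supp} g\subset[-KR^*,KR^*]$, and $\varphi(t)\to\varphi^*$ modulo $2\pi$, then $f(t)$ converges weakly, as $t\to+\infty$, to the probability measure $$f^*(d\vartheta,d\omega)=g(d\omega)\,\delta\Big(\vartheta-\varphi^*-\arcsin\frac{\omega}{KR^*}\Big),$$ i.e. the image of $g$ under $\omega\mapsto\big(\varphi^*+\arcsin\frac{\omega}{KR^*}\bmod 2\pi,\ \omega\big)$, and $R^*$ solves the self-consistency equation $$K(R^*)^2=\int_{\mathbb R}\sqrt{(KR^*)^2-\omega^2}\;g(d\omega).$$ -/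

import Mathlib

open Real Filter Topology MeasureTheory ProbabilityTheory

noncomputable section

/-- The one-dimensional torus `ℝ / 2πℤ` of phases. -/
abbrev Torus : Type := AddCircle (2 * π)

instance factTwoPiPos : Fact (0 < 2 * π) := ⟨Real.two_pi_pos⟩

/-- The space `𝒯 × ℝ` of pairs (phase, natural frequency). -/
abbrev PhaseSpace : Type := Torus × ℝ

/-- The conditional law of the phase given the frequency `ω`: the disintegration of `μ` along its
second coordinate, written `μ(ϑ, ω) dϑ` (normalised) when `μ` has a density. -/
def condPhase (μ : ProbabilityMeasure PhaseSpace) : Kernel ℝ Torus :=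
  ((μ : Measure PhaseSpace).map Prod.swap).condKernel

/-- The distribution `g` of the natural frequencies: the second marginal of the law. -/
def freqLaw (μ : ProbabilityMeasure PhaseSpace) : Measure ℝ :=
  (μ : Measure PhaseSpace).snd

/-- A (measure valued, weak) solution, for `t ≥ 0`, of the kinetic Kuramoto model with coupling
constant `K`, formulated through the characteristics.
`f t` is the law of (phase, frequency) at time `t`; `Θ t ϑ ω` is the phase at time `t` of
the oscillator with frequency `ω` that starts at `ϑ`; `R` and `φ` are the order parameters
(any real determination of the phase `φ` is allowed, and `φ t` is arbitrary when `R t = 0`). -/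
structure IsKineticKuramotoSolution (K : ℝ) (f : ℝ → ProbabilityMeasure PhaseSpace)
    (Θ : ℝ → Torus → ℝ → Torus) (R φ : ℝ → ℝ) : Prop where
  /-- The characteristics start at their label. -/
  init : ∀ ϑ ω, Θ 0 ϑ ω = ϑ
  /-- Each characteristic is the projection to the torus of a real curve `θ` that solves
  `θ' = ω - K R(t) sin (θ - φ(t))`. -/
  char : ∀ ϑ ω, ∃ θ : ℝ → ℝ, (∀ t, 0 ≤ t → (θ t : Torus) = Θ t ϑ ω) ∧
    ∀ t, 0 ≤ t →
      HasDerivWithinAt θ (ω - K * R t * Real.sin (θ t - φ t)) (Set.Ici 0) t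
  /-- `R(t) ≥ 0`. -/
  R_nonneg : ∀ t, 0 ≤ t → 0 ≤ R t
  /-- `R(t) e^{iφ(t)} = ∫ e^{iϑ} f(t, dϑ, dω)`. -/
  order : ∀ t, 0 ≤ t → (R t : ℂ) * Complex.exp (Complex.I * φ t) =
    ∫ x : PhaseSpace, (AddCircle.toCircle x.1 : ℂ) ∂(f t : Measure PhaseSpace)
  /-- `f(t)` is transported from `f(0)` along the characteristics. -/
  transport : ∀ t, 0 ≤ t → ∀ h : BoundedContinuousFunction PhaseSpace ℝ,
    ∫ x, h x ∂(f t : Measure PhaseSpace) =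
      ∫ x, h (Θ t x.1 x.2, x.2) ∂(f 0 : Measure PhaseSpace)

/-- The measure `g(ω) δ(ϑ - φ* - arcsin (ω / (K R*)))` on `𝒯 × ℝ`. -/
def lockedState (K Rs φs : ℝ) (g : Measure ℝ) : Measure PhaseSpace :=
  g.map fun ω => (((φs + Real.arcsin (ω / (K * Rs)) : ℝ) : Torus), ω)

instance freqLaw_isProbabilityMeasure (μ : ProbabilityMeasure PhaseSpace) :
    IsProbabilityMeasure (freqLaw μ) := by
  unfold freqLaw; infer_instance

instance lockedState_isProbabilityMeasure (K Rs φs : ℝ) (g : Measure ℝ)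
    [IsProbabilityMeasure g] : IsProbabilityMeasure (lockedState K Rs φs g) := by
  unfold lockedState
  apply Measure.isProbabilityMeasure_map
  apply Continuous.aemeasurable
  refine Continuous.prodMk ?_ continuous_id
  exact (AddCircle.continuous_mk' _).comp
    (continuous_const.add (Real.continuous_arcsin.comp (continuous_id.div_const _)))

end

/-! Write `κ = K R*`. In the frame of the limit phase, a characteristic solves `x' = ω - κ sin x +
e(t)`, where `e → 0` uniformly in the label. The two ranges of frequencies need different arguments.

For `|ω| < κ` the limit flow has one stable and one unstable rest point. A suitable coordinate turns
the equation into a perturbed logistic one, so each characteristic tends to one of the two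
(`cos_sub_tendsto_one_or_cos_add_tendsto_neg_one`). Two characteristics of the same frequency that
both tend to the unstable point would separate unless they were equal from the start
(`cos_sub_eq_one_of_repelling`). Hence each frequency has at most one exceptional initial phase, and
non-atomicity makes the exceptional set null (`ae_tendsto_locked`).

For `|ω| = κ` the rest point is only semi-stable, and a vanishing perturbation may still push an
oscillator around the circle again, so single trajectories are not enough. The extra information is
collective: `R(t)` converges and so does the subcritical contribution, hence the mean cosine of the
critical oscillators converges. With `e₀ = ω/κ = ±1`, `P = 1 - e₀ sin x` and `u = -cos x / P`, the
critical flow is a translation of `u`, while `cos x = -2u/(1+u²)` is a conjugate Poisson kernel and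
`P = 2/(1+u²)` a Poisson kernel. At late times the mean of the translated kernels is nearly
independent of the shift, so its truncated Hilbert transform nearly vanishes. Pointwise, that
transform bounds a positive multiple of `P` from above up to a small error
(`integral_translateKer_lower_bound`). Therefore the mean of `P` tends to zero
(`tendsto_integral_zero_of_critical`).

Both ranges together give L¹ convergence of the distance to the locked phase, hence weak
convergence. Testing the limit with a cosine yields the self-consistency equation. -/

/-! ### Scalar equations: the subcritical dichotomy and repulsion -/

/-- Dissipation of a scalar quantity in the region between two levels. -/
lemma eventually_le_of_logistic {h e : ℝ → ℝ} {l δ : ℝ} (hl : 0 < l) (hδ : 0 < δ)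
    (hδ' : δ < 1 / 2)
    (hd : ∀ t, 0 ≤ t → HasDerivWithinAt h (-l * (h t * (1 - h t)) + e t) (Set.Ici 0) t)
    (he : Tendsto e atTop (𝓝 0)) :
    ∃ T : ℝ, ∀ s, T ≤ s → h s ≤ 1 - δ → ∀ᶠ t in atTop, h t ≤ δ := by
  set c := l * (δ * (1 - δ)) / 2 with hc
  have hc0 : 0 < c := by
    have : 0 < δ * (1 - δ) := mul_pos hδ (by linarith)
    positivity
  obtain ⟨T, hT⟩ := eventually_atTop.1 (he.eventually (Iio_mem_nhds hc0))
  refine ⟨max T 0, fun s hs hhs => ?_⟩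
  have hs0 : 0 ≤ s := (le_max_right _ _).trans hs
  have hsT : T ≤ s := (le_max_left _ _).trans hs
  have hcont : ∀ a b, s ≤ a → ContinuousOn h (Set.Icc a b) := fun a b ha t ht =>
    ((hd t (by linarith [ht.1])).continuousWithinAt).mono
      fun u hu => hs0.trans (ha.trans hu.1)
  have hder : ∀ a b, s ≤ a → ∀ t ∈ Set.Ico a b,
      HasDerivWithinAt h (-l * (h t * (1 - h t)) + e t) (Set.Ici t) t := fun a b ha t ht =>
    (hd t (by linarith [ht.1])).mono (Set.Ici_subset_Ici.2 (by linarith [ht.1]))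
  have hneg : ∀ t, s ≤ t → δ ≤ h t → h t ≤ 1 - δ → -l * (h t * (1 - h t)) + e t < -c := by
    intro t ht h1 h2
    have : δ * (1 - δ) ≤ h t * (1 - h t) := by nlinarith
    have := mul_le_mul_of_nonneg_left this hl.le
    have := hT t (by linarith)
    linarith
  -- The time needed to descend from `1 - δ` to `δ` at speed `c`.
  set r := s + (1 - 2 * δ) / c with hr
  have hsr : s ≤ r := by
    have : 0 ≤ (1 - 2 * δ) / c := div_nonneg (by linarith) hc0.le
    linarith
  have hrc : c * (r - s) = 1 - 2 * δ := by rw [hr]; field_simp; ring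
  have hhr : h r ≤ δ := by
    have := image_le_of_deriv_right_lt_deriv_boundary (hcont s r le_rfl) (hder s r le_rfl)
      (B := fun t => 1 - δ - c * (t - s)) (B' := fun _ => -c) (by simpa using hhs)
      (fun t => by
        have := (((hasDerivAt_id t).sub_const s).const_mul c).const_sub (1 - δ)
        simpa using this)
      (fun t ht heq => by
        have h1 : c * (t - s) ≤ c * (r - s) := by
          apply mul_le_mul_of_nonneg_left _ hc0.le; linarith [ht.2]
        have h2 : 0 ≤ c * (t - s) := mul_nonneg hc0.le (by linarith [ht.1])
        exact hneg t ht.1 (by linarith) (by linarith)) (Set.right_mem_Icc.2 hsr)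
    linarith
  filter_upwards [eventually_ge_atTop r] with t ht
  exact image_le_of_deriv_right_lt_deriv_boundary (hcont r t hsr) (hder r t hsr)
      (B := fun _ => δ) (B' := fun _ => 0) hhr (fun t => hasDerivAt_const t δ)
      (fun t ht heq => by
        have := hneg t (hsr.trans ht.1) (by linarith) (by linarith)
        linarith) (Set.right_mem_Icc.2 ht)

/-- An asymptotically autonomous logistic equation on `[0, 1]` converges to a rest point. -/
lemma tendsto_zero_or_one_of_logistic {h e : ℝ → ℝ} {l : ℝ} (hl : 0 < l)
    (h01 : ∀ t, h t ∈ Set.Icc (0 : ℝ) 1)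
    (hd : ∀ t, 0 ≤ t → HasDerivWithinAt h (-l * (h t * (1 - h t)) + e t) (Set.Ici 0) t)
    (he : Tendsto e atTop (𝓝 0)) :
    Tendsto h atTop (𝓝 0) ∨ Tendsto h atTop (𝓝 1) := by
  by_cases H : ∀ δ > 0, ∀ᶠ t in atTop, 1 - δ < h t
  · right
    refine tendsto_order.2 ⟨fun b hb => ?_, fun b hb => Eventually.of_forall fun t => ?_⟩
    · filter_upwards [H (1 - b) (by linarith)] with t ht
      linarith
    · exact (h01 t).2.trans_lt hb
  · left
    push Not at H
    obtain ⟨δ₀, hδ₀, hfreq⟩ := H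
    refine tendsto_order.2 ⟨fun b hb => Eventually.of_forall fun t => hb.trans_le (h01 t).1,
      fun b hb => ?_⟩
    -- Shrinking `δ₀` keeps the late visits below `1 - δ`; the other bounds give `δ < b` and `δ <
    -- 1/2`.
    set δ := min δ₀ (min (b / 2) (1 / 4)) with hδ
    have hδ0 : 0 < δ := by positivity
    have hδb : δ ≤ b / 2 := (min_le_right _ _).trans (min_le_left _ _)
    have hδq : δ ≤ 1 / 4 := (min_le_right _ _).trans (min_le_right _ _)
    have hδδ : δ ≤ δ₀ := min_le_left _ _
    obtain ⟨T, hT⟩ := eventually_le_of_logistic hl hδ0 (by linarith) hd he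
    obtain ⟨s, hs, hsT⟩ := (hfreq.and_eventually (eventually_ge_atTop T)).exists
    filter_upwards [hT s hsT (by linarith)] with t ht
    linarith

/-- Dichotomy for the perturbed equation `x' = κ (sin a - sin x) + e`. -/
lemma cos_sub_tendsto_one_or_cos_add_tendsto_neg_one {x e : ℝ → ℝ} {κ a : ℝ} (hκ : 0 < κ)
    (ha : 0 < Real.cos a)
    (hx : ∀ t, 0 ≤ t →
      HasDerivWithinAt x (κ * (Real.sin a - Real.sin (x t)) + e t) (Set.Ici 0) t)
    (he : Tendsto e atTop (𝓝 0)) :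
    Tendsto (fun t => Real.cos (x t - a)) atTop (𝓝 1) ∨
      Tendsto (fun t => Real.cos (x t + a)) atTop (𝓝 (-1)) := by
  have hA : |Real.sin a| < 1 := by
    rw [← sq_lt_one_iff_abs_lt_one]
    nlinarith [Real.sin_sq_add_cos_sq a]
  have hden : ∀ y, 1 - |Real.sin a| ≤ 1 - Real.sin a * Real.sin y := fun y => by
    have h1 : |Real.sin a * Real.sin y| ≤ |Real.sin a| := by
      rw [abs_mul]
      exact mul_le_of_le_one_right (abs_nonneg _) (Real.abs_sin_le_one y)
    linarith [le_abs_self (Real.sin a * Real.sin y)]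
  set m := 1 - |Real.sin a| with hm
  have hm0 : 0 < m := by rw [hm]; linarith
  have hden0 : ∀ y, 0 < 1 - Real.sin a * Real.sin y := fun y => hm0.trans_le (hden y)
  -- Here `h / (1 - h) = sin²((x-a)/2) / cos²((x+a)/2)`, which decays like `exp(-2κ cos a · t)` when
  -- `e = 0`. So `h` is exactly logistic for the unperturbed flow, with `h = 0` at the stable point
  -- `a` and `h = 1` at the unstable point `π - a`.
  set h : ℝ → ℝ := fun t => (1 - Real.cos (x t - a)) / (2 * (1 - Real.sin a * Real.sin (x t)))
    with hh
  have h1h : ∀ t, 1 - h t =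
      (1 + Real.cos (x t + a)) / (2 * (1 - Real.sin a * Real.sin (x t))) := fun t => by
    have h2 := (hden0 (x t)).ne'
    simp only [hh, Real.cos_sub, Real.cos_add]
    rw [mul_comm (Real.sin (x t))]
    generalize Real.sin a * Real.sin (x t) = p at h2 ⊢
    field_simp
    ring
  have h01 : ∀ t, h t ∈ Set.Icc (0 : ℝ) 1 := fun t => by
    have h2 : 0 < 2 * (1 - Real.sin a * Real.sin (x t)) := by linarith [hden0 (x t)]
    constructor
    · exact div_nonneg (by linarith [Real.cos_le_one (x t - a)]) h2.le
    · have : 0 ≤ 1 - h t := by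
        rw [h1h]; exact div_nonneg (by linarith [Real.neg_one_le_cos (x t + a)]) h2.le
      linarith
  -- The derivative of `h` with respect to `x`, the factor by which `e` enters `h'`.
  set G : ℝ → ℝ := fun y => (Real.sin (y - a) * (1 - Real.sin a * Real.sin y)
    + (1 - Real.cos (y - a)) * (Real.sin a * Real.cos y)) /
      (2 * (1 - Real.sin a * Real.sin y) ^ 2) with hG
  have hGb : ∀ y, |G y| ≤ 4 / (2 * m ^ 2) := fun y => by
    rw [hG]
    simp only [abs_div]
    have hpos : 0 < 2 * (1 - Real.sin a * Real.sin y) ^ 2 := by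
      have := hden0 y; positivity
    rw [abs_of_pos hpos]
    apply div_le_div₀ (by norm_num) _ (by positivity)
    · have := hden y
      gcongr
    · refine (abs_add_le _ _).trans ?_
      rw [abs_mul, abs_mul, abs_mul]
      have b1 := Real.abs_sin_le_one (y - a)
      have b2 : |1 - Real.sin a * Real.sin y| ≤ 2 := by
        rw [abs_le]
        have : |Real.sin a * Real.sin y| ≤ 1 := by
          rw [abs_mul]
          exact mul_le_one₀ hA.le (abs_nonneg _) (Real.abs_sin_le_one y)
        constructor <;> linarith [(abs_le.1 this).1, (abs_le.1 this).2]
      have b3 : |1 - Real.cos (y - a)| ≤ 2 := by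
        rw [abs_le]
        constructor <;> linarith [Real.neg_one_le_cos (y - a), Real.cos_le_one (y - a)]
      have b4 : |Real.sin a| * |Real.cos y| ≤ 1 :=
        mul_le_one₀ hA.le (abs_nonneg _) (Real.abs_cos_le_one y)
      have c1 := mul_le_mul b1 b2 (abs_nonneg _) zero_le_one
      have c2 := mul_le_mul b3 b4 (by positivity) zero_le_two
      linarith
  have hd : ∀ t, 0 ≤ t → HasDerivWithinAt h
      (-(2 * κ * Real.cos a) * (h t * (1 - h t)) + G (x t) * e t) (Set.Ici 0) t := by
    intro t ht
    have hxt := hx t ht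
    have hn := ((hxt.sub_const a).cos).const_sub 1
    have hdn := ((hxt.sin.const_mul (Real.sin a)).const_sub 1).const_mul 2
    have hne : (2 * (1 - Real.sin a * Real.sin (x t))) ≠ 0 := by
      have := hden0 (x t); positivity
    refine (hn.fun_div hdn hne).congr_deriv ?_
    rw [h1h]
    simp only [hh, hG, Real.cos_sub, Real.cos_add, Real.sin_sub]
    have h3 := (hden0 (x t)).ne'
    have e1 := Real.sin_sq_add_cos_sq a
    have e2 := Real.sin_sq_add_cos_sq (x t)
    generalize Real.sin (x t) = X at *
    generalize Real.cos (x t) = Y at *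
    generalize Real.sin a = A at *
    generalize Real.cos a = B at *
    field_simp
    congr 1
    linear_combination (-κ * B * Y ^ 2) * e1 + (-κ * (A - X) * A * B - κ * B * (1 - A ^ 2)) * e2
  have hGe : Tendsto (fun t => G (x t) * e t) atTop (𝓝 0) :=
    bdd_le_mul_tendsto_zero' (4 / (2 * m ^ 2)) (Eventually.of_forall fun t => hGb _) he
  have hbd : ∀ t, 2 * (1 - Real.sin a * Real.sin (x t)) ≤ 4 := fun t => by
    have : |Real.sin a * Real.sin (x t)| ≤ 1 := by
      rw [abs_mul]
      exact mul_le_one₀ hA.le (abs_nonneg _) (Real.abs_sin_le_one _)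
    linarith [(abs_le.1 this).1]
  rcases tendsto_zero_or_one_of_logistic (by positivity) h01 hd hGe with H | H
  · left
    have : Tendsto (fun t => 1 - Real.cos (x t - a)) atTop (𝓝 0) := by
      refine squeeze_zero (fun t => by linarith [Real.cos_le_one (x t - a)]) (fun t => ?_)
        (by simpa using H.const_mul 4)
      have h2 : 0 < 2 * (1 - Real.sin a * Real.sin (x t)) := by linarith [hden0 (x t)]
      have := (h01 t).1
      calc 1 - Real.cos (x t - a) = h t * (2 * (1 - Real.sin a * Real.sin (x t))) := by
            simp only [hh]; rw [div_mul_cancel₀ _ h2.ne']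
        _ ≤ h t * 4 := mul_le_mul_of_nonneg_left (hbd t) this
        _ = 4 * h t := mul_comm _ _
    simpa using this.const_sub 1
  · right
    have : Tendsto (fun t => 1 + Real.cos (x t + a)) atTop (𝓝 0) := by
      refine squeeze_zero (fun t => by linarith [Real.neg_one_le_cos (x t + a)]) (fun t => ?_)
        (by simpa using (H.const_sub 1).const_mul 4)
      have h2 : 0 < 2 * (1 - Real.sin a * Real.sin (x t)) := by linarith [hden0 (x t)]
      have := (h01 t).2
      calc 1 + Real.cos (x t + a) = (1 - h t) * (2 * (1 - Real.sin a * Real.sin (x t))) := by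
            rw [h1h, div_mul_cancel₀ _ h2.ne']
        _ ≤ (1 - h t) * 4 := mul_le_mul_of_nonneg_left (hbd t) (by linarith)
        _ = 4 * (1 - h t) := mul_comm _ _
    simpa using this.sub_const 1

/-- Two solutions driven by the same field, which both spend all large times in the repelling
region and merge, coincide initially. -/
lemma cos_sub_eq_one_of_repelling {x y k φ : ℝ → ℝ} {K ω : ℝ}
    (hk : ∀ t, 0 ≤ t → 0 ≤ k t ∧ k t ≤ K)
    (hx : ∀ t, 0 ≤ t →
      HasDerivWithinAt x (ω - k t * Real.sin (x t - φ t)) (Set.Ici 0) t)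
    (hy : ∀ t, 0 ≤ t →
      HasDerivWithinAt y (ω - k t * Real.sin (y t - φ t)) (Set.Ici 0) t)
    (hxr : ∀ᶠ t in atTop, Real.cos (x t - φ t) ≤ 0)
    (hyr : ∀ᶠ t in atTop, Real.cos (y t - φ t) ≤ 0)
    (hxy : Tendsto (fun t => Real.cos (x t - y t)) atTop (𝓝 1)) :
    Real.cos (x 0 - y 0) = 1 := by
  set W : ℝ → ℝ := fun t => 1 - Real.cos (x t - y t) with hW
  have hW0 : ∀ t, 0 ≤ W t := fun t => by simp only [hW]; linarith [Real.cos_le_one (x t - y t)]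
  set m : ℝ → ℝ := fun t => -k t * (Real.cos (x t - φ t) + Real.cos (y t - φ t)) with hm
  have hWd : ∀ t, 0 ≤ t → HasDerivWithinAt W (m t * W t) (Set.Ici 0) t := by
    intro t ht
    refine (((hx t ht).fun_sub (hy t ht)).cos.const_sub 1).congr_deriv ?_
    simp only [hW, hm]
    have e1 : x t - φ t = ((x t - y t) / 2) + ((x t + y t) / 2 - φ t) := by ring
    have e2 : y t - φ t = ((x t + y t) / 2 - φ t) - ((x t - y t) / 2) := by ring
    have e3 : x t - y t = 2 * ((x t - y t) / 2) := by ring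
    rw [e1, e2]
    have e5 : Real.cos (x t - y t) = Real.cos (2 * ((x t - y t) / 2)) := by rw [← e3]
    have e6 : Real.sin (x t - y t) = Real.sin (2 * ((x t - y t) / 2)) := by rw [← e3]
    rw [e5, e6]
    have e4 := Real.sin_sq_add_cos_sq ((x t - y t) / 2)
    generalize (x t - y t) / 2 = D at *
    generalize (x t + y t) / 2 - φ t = M at *
    rw [Real.sin_add, Real.sin_sub, Real.cos_add, Real.cos_sub, Real.sin_two_mul,
      Real.cos_two_mul]
    linear_combination (-4 * k t * Real.cos D * Real.cos M) * e4
  have hcont : ContinuousOn W (Set.Ici 0) := fun t ht => (hWd t ht).continuousWithinAt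
  have hintg : ∀ t ∈ interior (Set.Ici (0 : ℝ)), HasDerivAt W (m t * W t) t := by
    intro t ht
    rw [interior_Ici] at ht
    exact (hWd t (le_of_lt ht)).hasDerivAt (Ici_mem_nhds ht)
  -- Since `m ≥ -2K`, `W` decays at most exponentially; a zero of `W` at a later time therefore
  -- forces `W 0 = 0`.
  have hmono1 : MonotoneOn (fun t => W t * Real.exp (2 * K * t)) (Set.Ici 0) := by
    refine monotoneOn_of_deriv_nonneg (convex_Ici 0) (hcont.mul (by fun_prop)) ?_ ?_
    · intro t ht
      exact ((hintg t ht).differentiableAt.mul (by fun_prop)).differentiableWithinAt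
    · intro t ht
      have h1 : HasDerivAt (fun t => Real.exp (2 * K * t)) (Real.exp (2 * K * t) * (2 * K)) t := by
        simpa using ((hasDerivAt_id t).const_mul (2 * K)).exp
      rw [((hintg t ht).fun_mul h1).deriv]
      rw [interior_Ici] at ht
      have hkt := hk t (le_of_lt ht)
      have hmK : 0 ≤ m t + 2 * K := by
        simp only [hm]
        nlinarith [Real.cos_le_one (x t - φ t), Real.cos_le_one (y t - φ t)]
      have : m t * W t * Real.exp (2 * K * t) + W t * (Real.exp (2 * K * t) * (2 * K)) =
        (m t + 2 * K) * (W t * Real.exp (2 * K * t)) := by ring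
      rw [this]
      exact mul_nonneg hmK (mul_nonneg (hW0 t) (Real.exp_pos _).le)
  obtain ⟨T, hT⟩ := eventually_atTop.1 ((hxr.and hyr).and (eventually_ge_atTop 0))
  have hT0 : 0 ≤ T := (hT T le_rfl).2
  -- In the repelling region `m ≥ 0`: `W` is nondecreasing yet tends to zero, so it vanishes at `T`.
  have hmono2 : MonotoneOn W (Set.Ici T) := by
    refine monotoneOn_of_deriv_nonneg (convex_Ici T)
      (hcont.mono (Set.Ici_subset_Ici.2 hT0)) ?_ ?_
    · intro t ht
      refine (hintg t ?_).differentiableAt.differentiableWithinAt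
      rw [interior_Ici] at ht ⊢
      exact lt_of_le_of_lt hT0 ht
    · intro t ht
      rw [interior_Ici] at ht
      have ht0 : 0 < t := lt_of_le_of_lt hT0 ht
      rw [(hintg t (by rw [interior_Ici]; exact ht0)).deriv]
      have h1 := (hT t (le_of_lt ht)).1
      have h2 := hk t ht0.le
      refine mul_nonneg ?_ (hW0 t)
      simp only [hm]
      nlinarith [h1.1, h1.2]
  have hWT : W T ≤ 0 := by
    have hlim : Tendsto W atTop (𝓝 0) := by simpa using hxy.const_sub 1
    refine ge_of_tendsto hlim ?_
    filter_upwards [eventually_ge_atTop T] with t ht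
    exact hmono2 (Set.mem_Ici.2 le_rfl) ht ht
  have h1 := hmono1 (Set.mem_Ici.2 le_rfl) hT0 hT0
  simp only [mul_zero, Real.exp_zero, mul_one] at h1
  have h2 : W T * Real.exp (2 * K * T) ≤ 0 :=
    mul_nonpos_of_nonpos_of_nonneg hWT (Real.exp_pos _).le
  have h3 := hW0 0
  have h4 : W 0 = 0 := le_antisymm (h1.trans h2) h3
  simp only [hW] at h4
  linarith

/-! ### The critical flow as a translation -/

/-- In the coordinate `u = -C / P`, in which the critical flow is a translation, the function
`-2 (u - s) / (1 + (u - s) ^ 2)`. -/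
noncomputable def translateKer (s P C : ℝ) : ℝ := (C + s * P) / (1 + s * C + s ^ 2 * P / 2)

lemma translateKer_zero (P C : ℝ) : translateKer 0 P C = C := by simp [translateKer]

/-- The relation says that `(P - 1, C)` lies on the unit circle. Half-angle coordinates turn the
denominator of `translateKer` into `(c - sS)² + S²`. -/
lemma exists_half_angle {P C : ℝ} (hP : 0 ≤ P) (hC : C ^ 2 = 2 * P - P ^ 2) :
    ∃ c S : ℝ, c ^ 2 + S ^ 2 = 1 ∧ P = 2 * S ^ 2 ∧ C = -2 * c * S := by
  rcases hP.eq_or_lt with rfl | hP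
  · exact ⟨1, 0, by norm_num, by norm_num, by nlinarith⟩
  · have hS : 0 < √(P / 2) := Real.sqrt_pos.2 (by linarith)
    have hS2 : √(P / 2) ^ 2 = P / 2 := Real.sq_sqrt (by linarith)
    refine ⟨-C / (2 * √(P / 2)), √(P / 2), ?_, by linarith, by field_simp⟩
    rw [div_pow, mul_pow, hS2, neg_sq, hC]
    field_simp
    ring

/-- In half-angle coordinates the difference of the two sides is a sum of squares. The bound is
uniform on the circle, including the rest point `P = 0`, where `u` is undefined. -/
lemma one_le_mul_translateKer_denom {P C : ℝ} (hP : 0 ≤ P) (hC : C ^ 2 = 2 * P - P ^ 2) (s : ℝ) :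
    1 ≤ (2 + 2 * s ^ 2) * (1 + s * C + s ^ 2 * P / 2) := by
  obtain ⟨c, S, h1, rfl, rfl⟩ := exists_half_angle hP hC
  have h2 : (2 + 2 * s ^ 2) * (1 + s * (-2 * c * S) + s ^ 2 * (2 * S ^ 2) / 2) - 1 =
      (c - s * S - s * S) ^ 2 + 2 * s ^ 2 * (c - s * S) ^ 2 + S ^ 2 := by
    linear_combination (-1 - 2 * s ^ 2) * h1
  nlinarith [sq_nonneg (c - s * S - s * S), sq_nonneg (s * (c - s * S)), sq_nonneg S]

lemma translateKer_denom_pos {P C : ℝ} (hP : 0 ≤ P) (hC : C ^ 2 = 2 * P - P ^ 2) (s : ℝ) :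
    0 < 1 + s * C + s ^ 2 * P / 2 := by
  have h1 := one_le_mul_translateKer_denom hP hC s
  have h2 : 0 < 2 + 2 * s ^ 2 := by positivity
  by_contra h
  push Not at h
  nlinarith

/-- Along solutions of `x' = κ (e₀ - sin x) + e` with `e₀ = ± 1` the translated kernels are
transported up to the size of `e`. -/
lemma abs_translateKer_sub_cos_le {x e : ℝ → ℝ} {κ e₀ T δ N τ b : ℝ} (he₀ : e₀ ^ 2 = 1)
    (hN : 1 ≤ N)
    (hx : ∀ t, T ≤ t → HasDerivWithinAt x (κ * (e₀ - Real.sin (x t)) + e t) (Set.Ici T) t)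
    (he : ∀ t, T ≤ t → |e t| ≤ δ) (hτ : T ≤ τ) (hb : T ≤ b) (hs : |κ * (b - τ)| ≤ N) :
    |translateKer (κ * (b - τ)) (1 - e₀ * Real.sin (x τ)) (Real.cos (x τ)) - Real.cos (x b)| ≤
      192 * N ^ 7 * δ * |b - τ| := by
  have hδ : 0 ≤ δ := (abs_nonneg _).trans (he τ hτ)
  have hPC : ∀ y, 0 ≤ 1 - e₀ * Real.sin y ∧
      Real.cos y ^ 2 = 2 * (1 - e₀ * Real.sin y) - (1 - e₀ * Real.sin y) ^ 2 := fun y => by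
    constructor
    · have : |e₀ * Real.sin y| ≤ 1 := by
        rw [← sq_le_one_iff_abs_le_one]
        nlinarith [Real.sin_sq_add_cos_sq y, sq_nonneg (Real.cos y)]
      linarith [(abs_le.1 this).2]
    · linear_combination Real.sin_sq_add_cos_sq y + (Real.sin y) ^ 2 * he₀
  -- For `e = 0` this is constant in `t`: it predicts `cos (x b)` from the state at time `t`. Only
  -- `e` contributes to its derivative, with factor `Γ`.
  set G : ℝ → ℝ := fun t =>
    translateKer (κ * (b - t)) (1 - e₀ * Real.sin (x t)) (Real.cos (x t)) with hG
  set Γ : ℝ → ℝ → ℝ := fun s y =>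
    ((-Real.sin y - s * e₀ * Real.cos y) *
        (1 + s * Real.cos y + s ^ 2 * (1 - e₀ * Real.sin y) / 2) -
      (Real.cos y + s * (1 - e₀ * Real.sin y)) *
        (-s * Real.sin y - s ^ 2 * e₀ * Real.cos y / 2)) /
      (1 + s * Real.cos y + s ^ 2 * (1 - e₀ * Real.sin y) / 2) ^ 2 with hΓ
  have hGd : ∀ t, T ≤ t →
      HasDerivWithinAt G (Γ (κ * (b - t)) (x t) * e t) (Set.Ici T) t := by
    intro t ht
    have hxt := hx t ht
    have hsd : HasDerivWithinAt (fun t => κ * (b - t)) (-κ) (Set.Ici T) t := by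
      simpa using (((hasDerivAt_id t).const_sub b).const_mul κ).hasDerivWithinAt
    have hP := (hxt.sin.const_mul e₀).const_sub 1
    have hn := hxt.cos.fun_add (hsd.fun_mul hP)
    have hd := ((hsd.fun_mul hxt.cos).const_add 1).fun_add
      (((hsd.fun_pow 2).fun_mul hP).div_const 2)
    have hne := (translateKer_denom_pos (hPC (x t)).1 (hPC (x t)).2 (κ * (b - t))).ne'
    refine (hn.fun_div hd hne).congr_deriv ?_
    simp only [hΓ]
    have e2 := Real.sin_sq_add_cos_sq (x t)
    generalize κ * (b - t) = s at *
    generalize Real.sin (x t) = X at *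
    generalize Real.cos (x t) = Y at *
    rw [div_mul_eq_mul_div]
    congr 1
    linear_combination
      κ * ((1 + s * Y + s ^ 2 * (1 - e₀ * X) / 2) - (Y + s * (1 - e₀ * X)) * s) * e2 +
      κ * (-s * Y * (1 + s * Y + s ^ 2 * (1 - e₀ * X) / 2) +
        (Y + s * (1 - e₀ * X)) * s ^ 2 * Y / 2) * he₀
  -- The numerator of `Γ` is at most `12 N³`, and the squared denominator is at least `(4 N²)⁻²`;
  -- `192 = 12 · 16`.
  have hΓb : ∀ s y, |s| ≤ N → |Γ s y| ≤ 192 * N ^ 7 := by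
    intro s y hs
    have hden := one_le_mul_translateKer_denom (hPC y).1 (hPC y).2 s
    have hpos := translateKer_denom_pos (hPC y).1 (hPC y).2 s
    have hs2 : s ^ 2 ≤ N ^ 2 := by rw [← sq_abs]; gcongr
    have hd : 1 ≤ (4 * N ^ 2) * (1 + s * Real.cos y + s ^ 2 * (1 - e₀ * Real.sin y) / 2) := by
      refine hden.trans (mul_le_mul_of_nonneg_right ?_ hpos.le)
      nlinarith
    have he1 : |e₀| = 1 := by
      rw [← sq_eq_sq₀ (abs_nonneg _) zero_le_one, sq_abs, he₀, one_pow]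
    have hX := Real.abs_sin_le_one y
    have hY := Real.abs_cos_le_one y
    have hP2 : |1 - e₀ * Real.sin y| ≤ 2 := by
      refine (abs_sub _ _).trans ?_
      rw [abs_one, abs_mul, he1, one_mul]; linarith
    have hsY : |s * Real.cos y| ≤ N := by
      rw [abs_mul]; nlinarith [abs_nonneg s, abs_nonneg (Real.cos y)]
    have hsX : |s * Real.sin y| ≤ N := by
      rw [abs_mul]; nlinarith [abs_nonneg s, abs_nonneg (Real.sin y)]
    have b1 : |-Real.sin y - s * e₀ * Real.cos y| ≤ 2 * N := by
      have : |s * e₀ * Real.cos y| ≤ N := by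
        rw [mul_right_comm, abs_mul, he1, mul_one]; exact hsY
      refine (abs_sub _ _).trans ?_
      rw [abs_neg]; linarith
    have b2 : |1 + s * Real.cos y + s ^ 2 * (1 - e₀ * Real.sin y) / 2| ≤ 3 * N ^ 2 := by
      have : |s ^ 2 * (1 - e₀ * Real.sin y) / 2| ≤ N ^ 2 := by
        rw [abs_div, abs_mul, abs_two, abs_of_nonneg (sq_nonneg s)]
        nlinarith [sq_nonneg s]
      refine (abs_add_le _ _).trans ?_
      have := abs_add_le 1 (s * Real.cos y)
      rw [abs_one] at this
      nlinarith
    have b3 : |Real.cos y + s * (1 - e₀ * Real.sin y)| ≤ 3 * N := by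
      refine (abs_add_le _ _).trans ?_
      rw [abs_mul]
      nlinarith [abs_nonneg s, abs_nonneg (1 - e₀ * Real.sin y)]
    have b4 : |-s * Real.sin y - s ^ 2 * e₀ * Real.cos y / 2| ≤ 2 * N ^ 2 := by
      have : |s ^ 2 * e₀ * Real.cos y / 2| ≤ N ^ 2 := by
        rw [abs_div, abs_mul, abs_mul, he1, abs_two, abs_of_nonneg (sq_nonneg s)]
        nlinarith [sq_nonneg s, abs_nonneg (Real.cos y)]
      refine (abs_sub _ _).trans ?_
      rw [neg_mul, abs_neg]
      nlinarith
    have c1 := mul_le_mul b1 b2 (abs_nonneg _) (by linarith)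
    have c2 := mul_le_mul b3 b4 (abs_nonneg _) (by linarith)
    simp only [hΓ]
    rw [abs_div, abs_of_pos (pow_pos hpos 2), div_le_iff₀ (pow_pos hpos 2)]
    refine (abs_sub _ _).trans ?_
    rw [abs_mul, abs_mul]
    refine (add_le_add c1 c2).trans ?_
    have hd2 := one_le_pow₀ hd (n := 2)
    have : 12 * N ^ 3 * 1 ≤ 12 * N ^ 3 *
        ((4 * N ^ 2) * (1 + s * Real.cos y + s ^ 2 * (1 - e₀ * Real.sin y) / 2)) ^ 2 :=
      mul_le_mul_of_nonneg_left hd2 (by positivity)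
    calc _ = 12 * N ^ 3 * 1 := by ring
      _ ≤ _ := this
      _ = _ := by ring
  have hsub : Set.uIcc τ b ⊆ Set.Ici T := fun t ht => by
    rcases Set.mem_uIcc.1 ht with h | h
    · exact hτ.trans h.1
    · exact hb.trans h.1
  have key := (convex_uIcc τ b).norm_image_sub_le_of_norm_hasDerivWithin_le
    (f := G) (f' := fun t => Γ (κ * (b - t)) (x t) * e t) (C := 192 * N ^ 7 * δ)
    (fun t ht => (hGd t (hsub ht)).mono hsub)
    (fun t ht => by
      rw [Real.norm_eq_abs, abs_mul]
      refine mul_le_mul (hΓb _ _ ?_) (he t (hsub ht)) (abs_nonneg _) (by positivity)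
      refine le_trans ?_ hs
      rw [abs_mul, abs_mul]
      refine mul_le_mul_of_nonneg_left ?_ (abs_nonneg _)
      exact Set.abs_sub_right_of_mem_uIcc ht)
    Set.left_mem_uIcc Set.right_mem_uIcc
  have hGb : G b = Real.cos (x b) := by simp [hG, translateKer_zero]
  rw [hGb, Real.norm_eq_abs, Real.norm_eq_abs, abs_sub_comm] at key
  exact key

/-! ### Truncated Hilbert transform of the conjugate Poisson kernel -/

lemma log_one_add_pow_four_le {q : ℝ} (hq : 0 ≤ q) : Real.log (1 + q ^ 4) ≤ 4 * q := by
  have h1 : 1 + q ^ 4 ≤ (1 + q) ^ 4 := by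
    have : 0 ≤ q ^ 3 := by positivity
    nlinarith [sq_nonneg q]
  calc Real.log (1 + q ^ 4) ≤ Real.log ((1 + q) ^ 4) := Real.log_le_log (by positivity) h1
    _ = 4 * Real.log (1 + q) := by rw [Real.log_pow]; norm_num
    _ ≤ 4 * q := by linarith [Real.log_le_sub_one_of_pos (show 0 < 1 + q by linarith)]

/-- The logarithmic boundary term must be small uniformly in `y`, also near `y = 8 / η ^ 4`. The
difference of logarithms is `log (1 + z) ≤ 4 z^(1/4)`; taking fourth powers leaves a polynomial
inequality, and the truncation point is chosen to make it true. -/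
lemma mul_log_ratio_le {η y : ℝ} (hη : 0 < η) (hy : 0 ≤ y) :
    y / (1 + y ^ 2) * (Real.log ((8 / η ^ 4 + y) ^ 2 + 1) - Real.log ((8 / η ^ 4 - y) ^ 2 + 1))
      ≤ 4 * η := by
  set N := 8 / η ^ 4 with hN
  have hN0 : 0 < N := by positivity
  set z := 4 * N * y / ((N - y) ^ 2 + 1) with hz
  have hz0 : 0 ≤ z := by positivity
  set q := √(√z) with hq
  have hq4 : q ^ 4 = z := by
    rw [show q ^ 4 = (q ^ 2) ^ 2 by ring, hq, Real.sq_sqrt (Real.sqrt_nonneg _),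
      Real.sq_sqrt hz0]
  have hq0 : 0 ≤ q := Real.sqrt_nonneg _
  have h1 : Real.log ((N + y) ^ 2 + 1) - Real.log ((N - y) ^ 2 + 1) ≤ 4 * q := by
    rw [← Real.log_div (by positivity) (by positivity)]
    refine le_trans (le_of_eq ?_) (log_one_add_pow_four_le hq0)
    rw [hq4, hz]
    congr 1
    field_simp
    ring
  have h2 : y / (1 + y ^ 2) * q ≤ η := by
    refine le_of_pow_le_pow_left₀ (n := 4) (by norm_num) hη.le ?_
    have hη4 : η ^ 4 = 8 / N := by rw [hN]; field_simp
    rw [mul_pow, hq4, hη4, hz, div_pow, div_mul_div_comm, div_le_div_iff₀ (by positivity) hN0]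
    have a1 : N ^ 2 ≤ 2 * (N - y) ^ 2 + 2 * y ^ 2 := by nlinarith [sq_nonneg (N - 2 * y)]
    have a2 : y ^ 5 ≤ (1 + y ^ 2) ^ 4 := by
      have e1 : y ≤ 1 + y ^ 2 := by nlinarith [sq_nonneg (y - 1)]
      have e2 : y ^ 2 ≤ 1 + y ^ 2 := by linarith
      have e3 : 1 ≤ 1 + y ^ 2 := by nlinarith
      calc y ^ 5 = y * y ^ 2 * y ^ 2 * 1 := by ring
        _ ≤ (1 + y ^ 2) * (1 + y ^ 2) * (1 + y ^ 2) * (1 + y ^ 2) := by gcongr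
        _ = _ := by ring
    have a3 : y ^ 7 ≤ (1 + y ^ 2) ^ 4 := by
      have e1 : y ≤ 1 + y ^ 2 := by nlinarith [sq_nonneg (y - 1)]
      have e2 : y ^ 2 ≤ 1 + y ^ 2 := by linarith
      calc y ^ 7 = y * y ^ 2 * y ^ 2 * y ^ 2 := by ring
        _ ≤ (1 + y ^ 2) * (1 + y ^ 2) * (1 + y ^ 2) * (1 + y ^ 2) := by gcongr
        _ = _ := by ring
    have a4 : N ^ 2 * y ^ 5 ≤ (2 * (N - y) ^ 2 + 2 * y ^ 2) * y ^ 5 :=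
      mul_le_mul_of_nonneg_right a1 (by positivity)
    have a5 : (N - y) ^ 2 * y ^ 5 ≤ (N - y) ^ 2 * (1 + y ^ 2) ^ 4 :=
      mul_le_mul_of_nonneg_left a2 (sq_nonneg _)
    nlinarith
  have h3 : 0 ≤ y / (1 + y ^ 2) := by positivity
  calc _ ≤ y / (1 + y ^ 2) * (4 * q) := mul_le_mul_of_nonneg_left h1 h3
    _ = 4 * (y / (1 + y ^ 2) * q) := by ring
    _ ≤ 4 * η := by linarith

lemma arctan_sub_arctan_le {a b : ℝ} (h : a ≤ b) : Real.arctan b - Real.arctan a ≤ b - a := by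
  have hmono : Monotone fun x => x - Real.arctan x := by
    refine monotone_of_deriv_nonneg (differentiable_id.sub Real.differentiable_arctan) fun x => ?_
    rw [((hasDerivAt_id' x).fun_sub (Real.hasDerivAt_arctan x)).deriv]
    have : 1 / (1 + x ^ 2) ≤ 1 := by
      rw [div_le_one (by positivity)]; nlinarith [sq_nonneg x]
    linarith
  have := hmono h
  simp only at this
  linarith

/-- The antiderivative used in the truncated Hilbert transform of the conjugate Poisson kernel. -/
noncomputable def hilbertPrimitive (u s : ℝ) : ℝ :=
  -(u / 2) * (Real.log ((s + u) ^ 2 + 1) - Real.log ((s - u) ^ 2 + 1)) +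
    (Real.arctan (s - u) + Real.arctan (s + u))

lemma hasDerivAt_hilbertPrimitive (u s : ℝ) :
    HasDerivAt (hilbertPrimitive u)
      (-(u / 2) * (2 * (s + u) / ((s + u) ^ 2 + 1) - 2 * (s - u) / ((s - u) ^ 2 + 1)) +
        (1 / (1 + (s - u) ^ 2) + 1 / (1 + (s + u) ^ 2))) s := by
  have h1 : HasDerivAt (fun s => s + u) 1 s := (hasDerivAt_id' s).add_const u
  have h2 : HasDerivAt (fun s => s - u) 1 s := (hasDerivAt_id' s).sub_const u
  have l1 := ((h1.fun_pow 2).add_const 1).log (by positivity)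
  have l2 := ((h2.fun_pow 2).add_const 1).log (by positivity)
  refine (((l1.fun_sub l2).const_mul (-(u / 2))).fun_add (h2.arctan.fun_add h1.arctan)).congr_deriv
    ?_
  norm_num

lemma hilbertPrimitive_neg (u s : ℝ) : hilbertPrimitive (-u) s = hilbertPrimitive u s := by
  simp only [hilbertPrimitive, sub_neg_eq_add, ← sub_eq_add_neg]
  ring

/-- The logarithms at the upper end cost `O(η)`. The arctangents there give at least `π/4`, unless
`u` is so large that `1 / (1 + u²) ≤ η`. The lower end `1/4` takes away at most `1/2`, which is less
than `π/4`, so a positive multiple of the Poisson kernel remains. -/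
lemma hilbertPrimitive_sub_lower_bound {η u : ℝ} (hη : 0 < η) (hη1 : η ≤ 1) (hu : 0 ≤ u) :
    1 / 2 * (1 / (1 + u ^ 2)) - 10 * η ≤
      2 / (1 + u ^ 2) * (hilbertPrimitive u (8 / η ^ 4) - hilbertPrimitive u (1 / 4)) := by
  have hlog := mul_log_ratio_le hη hu
  have hη4 : η ^ 4 ≤ η := by
    calc η ^ 4 ≤ η ^ 1 := pow_le_pow_of_le_one hη.le hη1 (by norm_num)
      _ = η := pow_one η
  have hN : 8 / η ≤ 8 / η ^ 4 := by gcongr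
  have hN8 : 8 ≤ 8 / η := by rw [le_div_iff₀ hη]; nlinarith
  set N := 8 / η ^ 4 with hNdef
  set L := Real.log ((N + u) ^ 2 + 1) - Real.log ((N - u) ^ 2 + 1) with hL
  have hp : 0 < 1 / (1 + u ^ 2) := by positivity
  have hquarter : hilbertPrimitive u (1 / 4) ≤ 1 / 2 := by
    have h1 : 0 ≤ Real.log ((1 / 4 + u) ^ 2 + 1) - Real.log ((1 / 4 - u) ^ 2 + 1) :=
      sub_nonneg.2 (Real.log_le_log (by positivity) (by nlinarith))
    have h2 := arctan_sub_arctan_le (show u - 1 / 4 ≤ 1 / 4 + u by linarith)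
    have h3 : Real.arctan (1 / 4 - u) = -Real.arctan (u - 1 / 4) := by
      rw [← Real.arctan_neg, neg_sub]
    simp only [hilbertPrimitive]
    have h4 := mul_nonneg hu h1
    rw [h3]
    linarith
  have hA0 : 0 ≤ Real.arctan (N - u) + Real.arctan (N + u) := by
    have h3 : Real.arctan (N - u) = -Real.arctan (u - N) := by
      rw [← Real.arctan_neg, neg_sub]
    have := Real.arctan_strictMono.monotone (show u - N ≤ N + u by linarith)
    linarith
  have hmain : 1 / 4 * (1 / (1 + u ^ 2)) - η ≤ 1 / (1 + u ^ 2) *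
      (Real.arctan (N - u) + Real.arctan (N + u) - 1 / 2) := by
    by_cases h : u ≤ N - 1
    · have h1 : π / 4 ≤ Real.arctan (N - u) := by
        rw [← Real.arctan_one]; exact Real.arctan_strictMono.monotone (by linarith)
      have h2 : 0 ≤ Real.arctan (N + u) := Real.arctan_nonneg.2 (by linarith)
      have h3 := Real.pi_gt_three
      nlinarith
    · push Not at h
      have h1 : 7 / η ≤ u := by
        have : 8 / η = 7 / η + 1 / η := by ring
        have : 1 ≤ 1 / η := by rw [le_div_iff₀ hη]; linarith
        linarith
      have h2 : 1 / (1 + u ^ 2) ≤ η := by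
        rw [div_le_iff₀ (by positivity)]
        have h5 : 7 ≤ u * η := by rwa [div_le_iff₀ hη] at h1
        have h7 : 1 ≤ u := by linarith
        nlinarith
      nlinarith
  have hl2 : 1 / (1 + u ^ 2) * (u * L) ≤ 4 * η := by
    calc _ = u / (1 + u ^ 2) * L := by ring
      _ ≤ _ := hlog
  have hfin : 2 / (1 + u ^ 2) * (hilbertPrimitive u N - hilbertPrimitive u (1 / 4)) =
      2 * (1 / (1 + u ^ 2) * (Real.arctan (N - u) + Real.arctan (N + u) - 1 / 2))
      - 1 / (1 + u ^ 2) * (u * L) +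
      2 * (1 / (1 + u ^ 2)) * (1 / 2 - hilbertPrimitive u (1 / 4)) := by
    have : hilbertPrimitive u N =
      -(u / 2) * L + (Real.arctan (N - u) + Real.arctan (N + u)) := rfl
    rw [this]; ring
  rw [hfin]
  have : 0 ≤ 2 * (1 / (1 + u ^ 2)) * (1 / 2 - hilbertPrimitive u (1 / 4)) :=
    mul_nonneg (by linarith) (by linarith)
  linarith

lemma continuousOn_translateKer_sub_div {P C : ℝ} (hP : 0 ≤ P) (hC : C ^ 2 = 2 * P - P ^ 2)
    {N : ℝ} (hN : 1 / 4 ≤ N) :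
    ContinuousOn (fun s => (translateKer s P C - translateKer (-s) P C) / s)
      (Set.uIcc (1 / 4) N) := by
  have hc : Continuous fun s => translateKer s P C := by
    unfold translateKer
    exact Continuous.div (by fun_prop) (by fun_prop)
      fun s => (translateKer_denom_pos hP hC s).ne'
  refine ContinuousOn.div (hc.sub (hc.comp continuous_neg)).continuousOn continuousOn_id ?_
  intro s hs
  rw [Set.uIcc_of_le hN] at hs
  exact (show (0 : ℝ) < s by linarith [hs.1]).ne'

/-- Positivity, up to a small error, of the truncated Hilbert transform of the order
parameter kernel. -/
lemma integral_translateKer_lower_bound {η P C : ℝ} (hη : 0 < η) (hη1 : η ≤ 1) (hP : 0 ≤ P)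
    (hC : C ^ 2 = 2 * P - P ^ 2) :
    1 / 4 * P - 10 * η ≤
      ∫ s in (1 / 4)..(8 / η ^ 4), (translateKer s P C - translateKer (-s) P C) / s := by
  have hN : 1 / 4 ≤ 8 / η ^ 4 := by
    rw [le_div_iff₀ (by positivity)]
    have : η ^ 4 ≤ 1 := pow_le_one₀ hη.le hη1
    linarith
  rcases hP.eq_or_lt with rfl | hP0
  · have hC0 : C = 0 := by nlinarith
    subst hC0
    simp [translateKer]
    linarith
  -- Away from the rest point, `P` and `C` are the Poisson kernel and its conjugate at `u`, and the
  -- integral is explicit.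
  · set u := -C / P with hu
    have hCu : C = -(u * P) := by rw [hu]; field_simp
    have hPu : P * (1 + u ^ 2) = 2 := by
      have : P * (P * (1 + u ^ 2)) = P * 2 := by
        rw [hCu] at hC
        linear_combination hC
      exact mul_left_cancel₀ hP0.ne' this
    have hP2 : P = 2 / (1 + u ^ 2) := by rw [eq_div_iff (by positivity), hPu]
    have hintg : ∫ s in (1 / 4)..(8 / η ^ 4), (translateKer s P C - translateKer (-s) P C) / s =
        P * hilbertPrimitive u (8 / η ^ 4) - P * hilbertPrimitive u (1 / 4) := by
      refine intervalIntegral.integral_eq_sub_of_hasDerivAt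
        (f := fun s => P * hilbertPrimitive u s) (fun s hs => ?_)
        (continuousOn_translateKer_sub_div hP hC hN).intervalIntegrable
      rw [Set.uIcc_of_le hN] at hs
      have hs0 : 0 < s := by linarith [hs.1]
      refine ((hasDerivAt_hilbertPrimitive u s).const_mul P).congr_deriv ?_
      have hk : ∀ r, translateKer r P C = -2 * (u - r) / ((r - u) ^ 2 + 1) := fun r => by
        unfold translateKer
        have h1 := (translateKer_denom_pos hP hC r).ne'
        rw [div_eq_div_iff h1 (by positivity), hCu]
        linear_combination (r - u) * hPu
      rw [hk, hk, hP2]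
      have e1 : (-s - u) ^ 2 + 1 = (s + u) ^ 2 + 1 := by ring
      have e2 : 1 + (s - u) ^ 2 = (s - u) ^ 2 + 1 := by ring
      have e3 : 1 + (s + u) ^ 2 = (s + u) ^ 2 + 1 := by ring
      rw [e1, e2, e3]
      field_simp
      ring
    rw [hintg, ← mul_sub]
    have key : ∀ v, 0 ≤ v → 1 / 2 * (1 / (1 + v ^ 2)) - 10 * η ≤
      2 / (1 + v ^ 2) * (hilbertPrimitive v (8 / η ^ 4) - hilbertPrimitive v (1 / 4)) :=
      fun v hv => hilbertPrimitive_sub_lower_bound hη hη1 hv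
    have key2 : 1 / 2 * (1 / (1 + u ^ 2)) - 10 * η ≤
      2 / (1 + u ^ 2) * (hilbertPrimitive u (8 / η ^ 4) - hilbertPrimitive u (1 / 4)) := by
      rcases le_total 0 u with h | h
      · exact key u h
      · simpa [hilbertPrimitive_neg] using key (-u) (by linarith)
    rw [hP2]
    refine le_trans (le_of_eq ?_) key2
    ring

/-! ### Trigonometry on the torus -/

/-- The cosine on the torus of phases. -/
noncomputable def torusCos (x : Torus) : ℝ := (AddCircle.toCircle x : ℂ).re

/-- The sine on the torus of phases. -/
noncomputable def torusSin (x : Torus) : ℝ := (AddCircle.toCircle x : ℂ).im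

lemma toCircle_coe_torus (r : ℝ) :
    (AddCircle.toCircle (r : Torus) : ℂ) = Complex.exp (r * Complex.I) := by
  rw [AddCircle.toCircle_apply_mk, div_self Real.two_pi_pos.ne', one_mul, Circle.coe_exp]

@[simp] lemma torusCos_coe (r : ℝ) : torusCos (r : Torus) = Real.cos r := by
  rw [torusCos, toCircle_coe_torus, Complex.exp_ofReal_mul_I_re]

@[simp] lemma torusSin_coe (r : ℝ) : torusSin (r : Torus) = Real.sin r := by
  rw [torusSin, toCircle_coe_torus, Complex.exp_ofReal_mul_I_im]

lemma continuous_torusCos : Continuous torusCos :=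
  Complex.continuous_re.comp (continuous_subtype_val.comp AddCircle.continuous_toCircle)

lemma continuous_torusSin : Continuous torusSin :=
  Complex.continuous_im.comp (continuous_subtype_val.comp AddCircle.continuous_toCircle)

lemma abs_torusCos_le_one (x : Torus) : |torusCos x| ≤ 1 := by
  obtain ⟨r, rfl⟩ := QuotientAddGroup.mk_surjective x
  exact (torusCos_coe r).symm ▸ Real.abs_cos_le_one r

/-- A cosine tending to one forces the sine to zero; the homeomorphism with the unit circle then
transfers the limit to the torus. -/
lemma tendsto_of_tendsto_torusCos_sub {ι : Type*} {l : Filter ι} {z : ι → Torus} {w : Torus}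
    (h : Tendsto (fun i => torusCos (z i - w)) l (𝓝 1)) : Tendsto z l (𝓝 w) := by
  have hsq : ∀ x : Torus, torusSin x ^ 2 = 1 - torusCos x ^ 2 := fun x => by
    obtain ⟨r, rfl⟩ := QuotientAddGroup.mk_surjective x
    have h1 := torusCos_coe r
    have h2 := torusSin_coe r
    change torusSin (r : Torus) ^ 2 = 1 - torusCos (r : Torus) ^ 2
    rw [h1, h2]
    exact Real.sin_sq r
  have hsin : Tendsto (fun i => torusSin (z i - w)) l (𝓝 0) := by
    have h1 : Tendsto (fun i => torusSin (z i - w) ^ 2) l (𝓝 0) := by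
      simp_rw [hsq]
      simpa using (h.pow 2).const_sub 1
    rw [tendsto_zero_iff_abs_tendsto_zero]
    have := h1.sqrt
    simpa [Real.sqrt_sq_eq_abs, Function.comp_def] using this
  have hC : Tendsto (fun i => (AddCircle.toCircle (z i - w) : ℂ)) l (𝓝 1) := by
    have := (Complex.continuous_ofReal.tendsto 1).comp h
    have h2 := ((Complex.continuous_ofReal.tendsto 0).comp hsin).mul_const Complex.I
    have h3 := this.add h2
    simp only [Function.comp_def, Complex.ofReal_one, Complex.ofReal_zero, zero_mul,
      add_zero] at h3
    refine h3.congr fun i => ?_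
    exact Complex.re_add_im _
  have hcirc : Tendsto (fun i => AddCircle.toCircle (z i - w)) l (𝓝 1) :=
    tendsto_subtype_rng.2 (by simpa using hC)
  have hz : Tendsto (fun i => z i - w) l (𝓝 0) := by
    have hind := (AddCircle.homeomorphCircle Real.two_pi_pos.ne').isInducing
    rw [hind.tendsto_nhds_iff]
    simpa [Function.comp_def, AddCircle.homeomorphCircle_apply] using hcirc
  simpa using hz.add_const w

lemma torus_eq_of_cos_sub_eq_one {r s : ℝ} (h : Real.cos (r - s) = 1) :
    (r : Torus) = (s : Torus) := by
  obtain ⟨n, hn⟩ := (Real.cos_eq_one_iff _).1 h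
  rw [← sub_eq_zero, ← AddCircle.coe_sub, ← hn]
  rw [AddCircle.coe_eq_zero_iff]
  exact ⟨n, by simp⟩

/-! ### Averaging over the critical oscillators -/

lemma abs_translateKer_le {s P C N : ℝ} (hP : 0 ≤ P) (hC : C ^ 2 = 2 * P - P ^ 2)
    (hs : |s| ≤ N) : |translateKer s P C| ≤ (1 + 2 * N) * (2 + 2 * N ^ 2) := by
  have h1 := one_le_mul_translateKer_denom hP hC s
  have h2 := translateKer_denom_pos hP hC s
  have hN : 0 ≤ N := (abs_nonneg _).trans hs
  have hP2 : P ≤ 2 := by nlinarith [sq_nonneg C]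
  have hC1 : |C| ≤ 1 := by rw [← sq_le_one_iff_abs_le_one]; nlinarith [sq_nonneg (P - 1)]
  have hs2 : s ^ 2 ≤ N ^ 2 := by rw [← sq_abs]; gcongr
  unfold translateKer
  rw [abs_div, abs_of_pos h2, div_le_iff₀ h2]
  have h3 : |C + s * P| ≤ 1 + 2 * N := by
    refine (abs_add_le _ _).trans ?_
    rw [abs_mul, abs_of_nonneg hP]
    nlinarith [abs_nonneg s]
  have h4 : 1 ≤ (2 + 2 * N ^ 2) * (1 + s * C + s ^ 2 * P / 2) :=
    h1.trans (mul_le_mul_of_nonneg_right (by linarith) h2.le)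
  rw [mul_assoc]
  nlinarith

/-- If a family of phases is asymptotically transported by the critical flow and its mean cosine
converges, then the phases concentrate at the rest point. -/
lemma tendsto_integral_zero_of_critical {Ω : Type*} [MeasurableSpace Ω] {σ : Measure Ω}
    [IsFiniteMeasure σ] {c P : ℝ → Ω → ℝ} {κ L : ℝ} (hκ : 0 < κ)
    (hcm : ∀ t, 0 ≤ t → AEMeasurable (c t) σ) (hPm : ∀ t, 0 ≤ t → AEMeasurable (P t) σ)
    (hP : ∀ t, 0 ≤ t → ∀ᵐ w ∂σ, 0 ≤ P t w)
    (hcP : ∀ t, 0 ≤ t → ∀ᵐ w ∂σ, c t w ^ 2 = 2 * P t w - P t w ^ 2)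
    (htr : ∀ N, 1 ≤ N → ∀ ε, 0 < ε → ∃ T, ∀ τ b, T ≤ τ → T ≤ b → |κ * (b - τ)| ≤ N →
      ∀ᵐ w ∂σ, |translateKer (κ * (b - τ)) (P τ w) (c τ w) - c b w| ≤ ε)
    (hL : Tendsto (fun t => ∫ w, c t w ∂σ) atTop (𝓝 L)) :
    Tendsto (fun t => ∫ w, P t w ∂σ) atTop (𝓝 0) := by
  set m := σ.real Set.univ with hm
  have hm0 : 0 ≤ m := measureReal_nonneg
  have hintk : ∀ s t, 0 ≤ t → Integrable (fun w => translateKer s (P t w) (c t w)) σ := by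
    intro s t ht
    refine Integrable.of_bound (C := (1 + 2 * |s|) * (2 + 2 * |s| ^ 2)) ?_ ?_
    · have h1 := hcm t ht
      have h2 := hPm t ht
      unfold translateKer
      exact AEMeasurable.aestronglyMeasurable (by fun_prop)
    · filter_upwards [hP t ht, hcP t ht] with w h1 h2
      exact abs_translateKer_le h1 h2 le_rfl
  have hintc : ∀ t, 0 ≤ t → Integrable (c t) σ := fun t ht => by
    simpa [translateKer_zero] using hintk 0 t ht
  have hintP : ∀ t, 0 ≤ t → Integrable (P t) σ := fun t ht => by
    refine Integrable.of_bound (C := 2) (hPm t ht).aestronglyMeasurable ?_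
    filter_upwards [hP t ht, hcP t ht] with w h1 h2
    rw [Real.norm_eq_abs, abs_of_nonneg h1]
    nlinarith [sq_nonneg (c t w)]
  have main : ∀ η, 0 < η → η ≤ 1 → ∀ᶠ t in atTop, ∫ w, P t w ∂σ ≤ (40 * m + 4) * η := by
    intro η hη hη1
    set N := 8 / η ^ 4 with hN
    have hN1 : 1 ≤ N := by
      rw [hN, le_div_iff₀ (by positivity)]
      have : η ^ 4 ≤ 1 := pow_le_one₀ hη.le hη1
      linarith
    -- Chosen so that `8 ε (m + 1) N = η` in the upper bound of the transform.
    set ε := η / (4 * (2 * m + 2) * N) with hε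
    have hε0 : 0 < ε := by positivity
    obtain ⟨T, hT⟩ := htr N hN1 ε hε0
    obtain ⟨T', hT'⟩ := eventually_atTop.1 (hL.eventually (Metric.ball_mem_nhds L hε0))
    -- The margin `N / κ` keeps the shifted times `t + s / κ` late for negative `s` too.
    filter_upwards [eventually_ge_atTop (max (max T T') 0 + N / κ)] with t ht
    have hNκ : 0 ≤ N / κ := by positivity
    have ht0 : 0 ≤ t := by linarith [le_max_right (max T T') 0]
    have hmax : max T T' ≤ t - N / κ := by linarith [le_max_left (max T T') 0]
    have hmax0 : 0 ≤ t - N / κ := by linarith [le_max_right (max T T') 0]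
    have hTt : T ≤ t - N / κ := (le_max_left _ _).trans hmax
    have hTt' : T' ≤ t - N / κ := (le_max_right _ _).trans hmax
    have hone : ∀ s, |s| ≤ N →
        |∫ w, translateKer s (P t w) (c t w) ∂σ - L| ≤ ε * (m + 1) := by
      intro s hs
      have hsk : |s / κ| ≤ N / κ := by rw [abs_div, abs_of_pos hκ]; gcongr
      have hb : t - N / κ ≤ t + s / κ := by linarith [(abs_le.1 hsk).1]
      have hks : κ * (t + s / κ - t) = s := by rw [add_sub_cancel_left, mul_div_cancel₀ _ hκ.ne']
      have h1 := hT t (t + s / κ) (by linarith) (hTt.trans hb) (by rwa [hks])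
      rw [hks] at h1
      have h2 : ‖∫ w, (translateKer s (P t w) (c t w) - c (t + s / κ) w) ∂σ‖ ≤ ε * m :=
        norm_integral_le_of_norm_le_const h1
      rw [integral_sub (hintk s t ht0) (hintc _ (hmax0.trans hb)), Real.norm_eq_abs] at h2
      have h3 := hT' (t + s / κ) (hTt'.trans hb)
      rw [Real.dist_eq] at h3
      have h4 := abs_add_le (∫ w, translateKer s (P t w) (c t w) ∂σ - ∫ w, c (t + s / κ) w ∂σ)
        (∫ w, c (t + s / κ) w ∂σ - L)
      rw [sub_add_sub_cancel] at h4
      linarith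
    have hN4 : 1 / 4 ≤ N := by linarith
    set F : Ω → ℝ → ℝ := fun w s =>
      (translateKer s (P t w) (c t w) - translateKer (-s) (P t w) (c t w)) / s with hF
    have hintF : Integrable (Function.uncurry F)
        (σ.prod (volume.restrict (Set.Ioc (1 / 4) N))) := by
      refine Integrable.of_bound (C := 8 * ((1 + 2 * N) * (2 + 2 * N ^ 2))) ?_ ?_
      · have h1 : AEMeasurable (fun z : Ω × ℝ => c t z.1)
            (σ.prod (volume.restrict (Set.Ioc (1 / 4) N))) :=
          (hcm t ht0).comp_quasiMeasurePreserving Measure.quasiMeasurePreserving_fst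
        have h2 : AEMeasurable (fun z : Ω × ℝ => P t z.1)
            (σ.prod (volume.restrict (Set.Ioc (1 / 4) N))) :=
          (hPm t ht0).comp_quasiMeasurePreserving Measure.quasiMeasurePreserving_fst
        refine AEMeasurable.aestronglyMeasurable ?_
        simp only [hF, translateKer, Function.uncurry_def]
        fun_prop
      · have h1 := (Measure.quasiMeasurePreserving_fst (μ := σ)
          (ν := volume.restrict (Set.Ioc (1 / 4) N))).ae ((hP t ht0).and (hcP t ht0))
        have h2 := (Measure.quasiMeasurePreserving_snd (μ := σ)
          (ν := volume.restrict (Set.Ioc (1 / 4) N))).ae (ae_restrict_mem measurableSet_Ioc)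
        filter_upwards [h1, h2] with z hz1 hz2
        have hz0 : 0 < z.2 := by linarith [hz2.1]
        have hzN : |z.2| ≤ N := by rw [abs_of_pos hz0]; exact hz2.2
        simp only [hF, Function.uncurry_def, norm_div, Real.norm_eq_abs]
        rw [div_le_iff₀ (abs_pos.2 hz0.ne'), abs_of_pos hz0]
        have b1 := abs_translateKer_le hz1.1 hz1.2 hzN
        have b2 := abs_translateKer_le hz1.1 hz1.2 (s := -z.2) (N := N) (by rwa [abs_neg])
        refine (abs_sub _ _).trans ?_
        have : 0 ≤ (1 + 2 * N) * (2 + 2 * N ^ 2) := by positivity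
        nlinarith [hz2.1]
    -- Fubini sets the pointwise lower bound, integrated over `w`, against the smallness of the
    -- averaged kernels at each shift.
    have hswap : ∫ w, (∫ s in (1 / 4)..N, F w s) ∂σ = ∫ s in (1 / 4)..N, (∫ w, F w s ∂σ) := by
      simp_rw [intervalIntegral.integral_of_le hN4]
      exact integral_integral_swap hintF
    have hupper : ∫ s in (1 / 4)..N, (∫ w, F w s ∂σ) ≤ η := by
      have h1 : ‖∫ s in (1 / 4)..N, (∫ w, F w s ∂σ)‖ ≤ 4 * (2 * (ε * (m + 1))) * |N - 1 / 4| := by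
        refine intervalIntegral.norm_integral_le_of_norm_le_const fun s hs => ?_
        rw [Set.uIoc_of_le hN4] at hs
        have hs0 : 0 < s := by linarith [hs.1]
        have hsN : |s| ≤ N := by rw [abs_of_pos hs0]; exact hs.2
        simp only [hF]
        rw [integral_div, integral_sub (hintk _ _ ht0) (hintk _ _ ht0), norm_div,
          Real.norm_eq_abs, Real.norm_eq_abs, abs_of_pos hs0, div_le_iff₀ hs0]
        have a1 := hone s hsN
        have a2 := hone (-s) (by rwa [abs_neg])
        have a3 := abs_sub_le (∫ w, translateKer s (P t w) (c t w) ∂σ) L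
          (∫ w, translateKer (-s) (P t w) (c t w) ∂σ)
        rw [abs_sub_comm L] at a3
        have : 0 ≤ ε * (m + 1) := by positivity
        nlinarith [hs.1]
      refine (le_abs_self _).trans (h1.trans ?_)
      rw [abs_of_nonneg (by linarith)]
      have h2 : 4 * (2 * (ε * (m + 1))) * (N - 1 / 4) ≤ 4 * (2 * (ε * (m + 1))) * N := by
        apply mul_le_mul_of_nonneg_left (by linarith) (by positivity)
      refine h2.trans (le_of_eq ?_)
      rw [hε]
      field_simp
    have hlower : ∫ w, (1 / 4 * P t w - 10 * η) ∂σ ≤ ∫ w, (∫ s in (1 / 4)..N, F w s) ∂σ := by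
      refine integral_mono_ae (((hintP t ht0).const_mul _).sub (integrable_const _)) ?_ ?_
      · simp_rw [intervalIntegral.integral_of_le hN4]
        exact hintF.integral_prod_left
      · filter_upwards [hP t ht0, hcP t ht0] with w h1 h2
        exact integral_translateKer_lower_bound hη hη1 h1 h2
    rw [integral_sub ((hintP t ht0).const_mul _) (integrable_const _), integral_const_mul,
      integral_const, smul_eq_mul, ← hm] at hlower
    rw [hswap] at hlower
    linarith
  refine tendsto_order.2 ⟨fun b hb => ?_, fun b hb => ?_⟩
  · filter_upwards [eventually_ge_atTop 0] with t ht
    exact hb.trans_le (integral_nonneg_of_ae (hP t ht))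
  · set η := min 1 (b / (2 * (40 * m + 4))) with hη
    have hη0 : 0 < η := by positivity
    filter_upwards [main η hη0 (min_le_left _ _)] with t ht
    have h1 : η ≤ b / (2 * (40 * m + 4)) := min_le_right _ _
    rw [le_div_iff₀ (by positivity)] at h1
    linarith

/-! ### Null sets from non-atomic conditional laws -/

/-- A measurable set whose slices at fixed frequency have at most one phase is null, if the
conditional laws of the phase are non-atomic. -/
lemma measure_eq_zero_of_subsingleton_slices (μ : ProbabilityMeasure PhaseSpace)
    (hna : ∀ᵐ ω ∂(freqLaw μ), NullSingletonClass (condPhase μ ω)) {B : Set PhaseSpace}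
    (hB : MeasurableSet B) (hs : ∀ ω, {ϑ : Torus | (ϑ, ω) ∈ B}.Subsingleton) :
    (μ : Measure PhaseSpace) B = 0 := by
  set ν : Measure (ℝ × Torus) := (μ : Measure PhaseSpace).map Prod.swap with hν
  have hprob : IsProbabilityMeasure ν := Measure.isProbabilityMeasure_map (by fun_prop)
  have hfst : ν.fst = freqLaw μ := by
    rw [hν, freqLaw, Measure.fst, Measure.map_map measurable_fst measurable_swap]
    rfl
  have h1 : (μ : Measure PhaseSpace) B = ν (Prod.swap ⁻¹' B) := by
    rw [hν, Measure.map_apply measurable_swap (measurable_swap hB)]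
    rfl
  rw [h1, ← ν.disintegrate ν.condKernel,
    Measure.compProd_apply (measurable_swap hB), hfst, lintegral_eq_zero_iff']
  · filter_upwards [hna] with ω hω
    have : (Prod.mk ω ⁻¹' (Prod.swap ⁻¹' B)) = {ϑ : Torus | (ϑ, ω) ∈ B} := rfl
    rw [this]
    exact (hs ω).measure_zero (condPhase μ ω)
  · exact (Kernel.measurable_kernel_prodMk_left (measurable_swap hB)).aemeasurable

/-! ### Regularity and lifts of the characteristics -/

lemma torus_norm_coe_le (r : ℝ) : ‖(r : Torus)‖ ≤ |r| := by
  rw [AddCircle.norm_eq]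
  have h := round_le ((2 * π)⁻¹ * r) 0
  have hp : (0 : ℝ) < 2 * π := Real.two_pi_pos
  have e1 : r - round ((2 * π)⁻¹ * r) * (2 * π) =
      ((2 * π)⁻¹ * r - round ((2 * π)⁻¹ * r)) * (2 * π) := by
    rw [sub_mul]; congr 1; field_simp
  have e2 : |r| = |(2 * π)⁻¹ * r - (0 : ℤ)| * (2 * π) := by
    rw [Int.cast_zero, sub_zero, abs_mul, abs_of_pos (inv_pos.2 hp)]; field_simp
  rw [e1, abs_mul, abs_of_pos hp, e2]
  exact mul_le_mul_of_nonneg_right h hp.le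

namespace IsKineticKuramotoSolution

variable {K : ℝ} {f : ℝ → ProbabilityMeasure PhaseSpace} {Θ : ℝ → Torus → ℝ → Torus}
  {R φ : ℝ → ℝ}

lemma R_le_one (hsol : IsKineticKuramotoSolution K f Θ R φ) {t : ℝ} (ht : 0 ≤ t) : R t ≤ 1 := by
  have h1 := congrArg norm (hsol.order t ht)
  rw [norm_mul, mul_comm Complex.I, Complex.norm_exp_ofReal_mul_I, mul_one, Complex.norm_real,
    Real.norm_of_nonneg (hsol.R_nonneg t ht)] at h1
  rw [h1]
  have := norm_integral_le_of_norm_le_const (μ := (f t : Measure PhaseSpace)) (C := 1)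
    (f := fun x : PhaseSpace => (AddCircle.toCircle x.1 : ℂ))
    (Eventually.of_forall fun x => (Circle.norm_coe _).le)
  simpa using this

lemma integral_torusCos (hsol : IsKineticKuramotoSolution K f Θ R φ) (ψ : ℝ) {t : ℝ}
    (ht : 0 ≤ t) :
    ∫ x : PhaseSpace, torusCos (x.1 - (ψ : Torus)) ∂(f t : Measure PhaseSpace) =
      R t * Real.cos (φ t - ψ) := by
  have hintg : Integrable (fun x : PhaseSpace => (AddCircle.toCircle (x.1 - (ψ : Torus)) : ℂ))
      (f t : Measure PhaseSpace) := by
    refine Integrable.of_bound (C := 1) ?_ (Eventually.of_forall fun x => (Circle.norm_coe _).le)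
    refine Continuous.aestronglyMeasurable ?_
    exact continuous_subtype_val.comp (AddCircle.continuous_toCircle.comp (by fun_prop))
  have h1 : ∫ x : PhaseSpace, torusCos (x.1 - (ψ : Torus)) ∂(f t : Measure PhaseSpace) =
      (∫ x : PhaseSpace, (AddCircle.toCircle (x.1 - (ψ : Torus)) : ℂ)
        ∂(f t : Measure PhaseSpace)).re :=
    Complex.reCLM.integral_comp_comm hintg
  have h2 : ∀ x : PhaseSpace, (AddCircle.toCircle (x.1 - (ψ : Torus)) : ℂ) =
      AddCircle.toCircle x.1 * Complex.exp ((-ψ : ℝ) * Complex.I) := fun x => by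
    rw [sub_eq_add_neg, ← AddCircle.coe_neg, AddCircle.toCircle_add, Circle.coe_mul,
      toCircle_coe_torus]
  rw [h1]
  simp_rw [h2]
  rw [integral_mul_const, ← hsol.order t ht, mul_assoc, mul_comm Complex.I, ← Complex.exp_add,
    ← add_mul, ← Complex.ofReal_add, Complex.re_ofReal_mul, Complex.exp_ofReal_mul_I_re,
    ← sub_eq_add_neg]

/-- Two characteristics stay close on bounded time intervals. -/
lemma dist_char_le (hsol : IsKineticKuramotoSolution K f Θ R φ) (hK : 0 < K) {t : ℝ}
    (ht : 0 ≤ t) (p q : PhaseSpace) :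
    dist (Θ t p.1 p.2) (Θ t q.1 q.2) ≤ gronwallBound (dist p.1 q.1) K |p.2 - q.2| t := by
  obtain ⟨θ, hθ, hθd⟩ := hsol.char p.1 p.2
  obtain ⟨η, hη, hηd⟩ := hsol.char q.1 q.2
  -- Selects the lift for which the real distance at time zero equals the distance on the torus.
  set n : ℤ := round ((2 * π)⁻¹ * (θ 0 - η 0)) with hn
  set ζ : ℝ → ℝ := fun s => θ s - n * (2 * π) with hζ
  have hζd : ∀ s, 0 ≤ s →
      HasDerivWithinAt ζ (p.2 - K * R s * Real.sin (ζ s - φ s)) (Set.Ici 0) s := fun s hs => by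
    have : ζ s - φ s = θ s - φ s - n * (2 * π) := by simp only [hζ]; ring
    rw [this, Real.sin_sub_int_mul_two_pi]
    exact (hθd s hs).sub_const _
  have hζc : ∀ s, (ζ s : Torus) = (θ s : Torus) := fun s => by
    simp only [hζ]
    rw [AddCircle.coe_sub, sub_eq_self, AddCircle.coe_eq_zero_iff]
    exact ⟨n, by simp⟩
  have h0 : dist (ζ 0) (η 0) ≤ dist p.1 q.1 := by
    rw [← hsol.init p.1 p.2, ← hsol.init q.1 q.2, ← hθ 0 le_rfl, ← hη 0 le_rfl, dist_eq_norm,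
      dist_eq_norm, ← AddCircle.coe_sub, AddCircle.norm_eq, Real.norm_eq_abs]
    refine le_of_eq ?_
    congr 1
    simp only [hζ, hn]
    ring
  have key := dist_le_of_approx_trajectories_ODE_of_mem
    (v := fun s x => q.2 - K * R s * Real.sin (x - φ s)) (s := fun _ => Set.univ)
    (K := ⟨K, hK.le⟩) (a := 0) (b := t) (f := ζ) (g := η)
    (f' := fun s => p.2 - K * R s * Real.sin (ζ s - φ s))
    (g' := fun s => q.2 - K * R s * Real.sin (η s - φ s)) (εf := |p.2 - q.2|) (εg := 0)
    (δ := dist p.1 q.1)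
    (fun s hs => by
      refine LipschitzWith.lipschitzOnWith (LipschitzWith.of_dist_le_mul fun x y => ?_)
      have hR0 := hsol.R_nonneg s hs.1
      have hR1 := hsol.R_le_one hs.1
      rw [Real.dist_eq, Real.dist_eq]
      have e1 : q.2 - K * R s * Real.sin (x - φ s) - (q.2 - K * R s * Real.sin (y - φ s)) =
        K * R s * (Real.sin (y - φ s) - Real.sin (x - φ s)) := by ring
      have e2 := Real.abs_sin_sub_sin_le (y - φ s) (x - φ s)
      rw [sub_sub_sub_cancel_right, abs_sub_comm y x] at e2
      rw [e1, abs_mul, abs_of_nonneg (by positivity)]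
      change K * R s * _ ≤ K * _
      have : K * R s ≤ K := by nlinarith
      exact mul_le_mul this e2 (abs_nonneg _) hK.le)
    (fun s hs => ((hζd s hs.1).continuousWithinAt).mono Set.Icc_subset_Ici_self)
    (fun s hs => (hζd s hs.1).mono (Set.Ici_subset_Ici.2 hs.1))
    (fun s _ => by rw [Real.dist_eq]; refine le_of_eq ?_; congr 1; ring)
    (fun _ _ => trivial)
    (fun s hs => ((hηd s hs.1).continuousWithinAt).mono Set.Icc_subset_Ici_self)
    (fun s hs => (hηd s hs.1).mono (Set.Ici_subset_Ici.2 hs.1))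
    (fun s _ => by rw [dist_self])
    (fun _ _ => trivial) h0 t (Set.right_mem_Icc.2 ht)
  rw [add_zero, sub_zero] at key
  refine le_trans ?_ key
  rw [← hθ t ht, ← hη t ht, ← hζc, dist_eq_norm, ← AddCircle.coe_sub, Real.dist_eq]
  exact torus_norm_coe_le _

/-- Gronwall supplies the joint continuity in the label, which is not part of the definition of a
solution; it makes the sets and integrands on label space measurable. -/
lemma continuous_char (hsol : IsKineticKuramotoSolution K f Θ R φ) (hK : 0 < K) {t : ℝ}
    (ht : 0 ≤ t) : Continuous fun p : PhaseSpace => Θ t p.1 p.2 := by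
  refine continuous_iff_continuousAt.2 fun q => ?_
  rw [ContinuousAt, tendsto_iff_dist_tendsto_zero]
  refine squeeze_zero (fun _ => dist_nonneg) (fun p => hsol.dist_char_le hK ht p q) ?_
  simp_rw [gronwallBound_of_K_ne_0 hK.ne']
  have : Continuous fun p : PhaseSpace =>
      dist p.1 q.1 * Real.exp (K * t) + |p.2 - q.2| / K * (Real.exp (K * t) - 1) := by fun_prop
  simpa using this.tendsto q

/-- In the frame of the limit phase, characteristics solve an asymptotically autonomous equation,
with an error that is uniform in the label. -/
lemma exists_lift (hsol : IsKineticKuramotoSolution K f Θ R φ) (hK : 0 < K) (Rs φs : ℝ)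
    (ϑ : Torus) (ω : ℝ) :
    ∃ x e : ℝ → ℝ, (∀ t, 0 ≤ t → (x t : Torus) = Θ t ϑ ω - (φs : Torus)) ∧
      (∀ t, 0 ≤ t → HasDerivWithinAt x (ω - K * R t * Real.sin (x t - (φ t - φs)))
        (Set.Ici 0) t) ∧
      (∀ t, ω - K * R t * Real.sin (x t - (φ t - φs)) = ω - K * Rs * Real.sin (x t) + e t) ∧
      ∀ t, |e t| ≤ K * (|R t * Real.cos (φ t - φs) - Rs| + |R t * Real.sin (φ t - φs)|) := by
  obtain ⟨θ, hθ, hθd⟩ := hsol.char ϑ ω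
  refine ⟨fun t => θ t - φs, fun t => K * (Real.cos (θ t - φs) * (R t * Real.sin (φ t - φs)) -
    Real.sin (θ t - φs) * (R t * Real.cos (φ t - φs) - Rs)), fun t ht => ?_, fun t ht => ?_,
    fun t => ?_, fun t => ?_⟩
  · rw [AddCircle.coe_sub, hθ t ht]
  · have := (hθd t ht).sub_const φs
    rwa [show θ t - φs - (φ t - φs) = θ t - φ t by ring]
  · rw [Real.sin_sub (θ t - φs)]; ring
  · rw [abs_mul, abs_of_pos hK]
    refine mul_le_mul_of_nonneg_left ((abs_sub _ _).trans ?_) hK.le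
    rw [add_comm, abs_mul (Real.sin (θ t - φs)), abs_mul (Real.cos (θ t - φs))]
    exact add_le_add (mul_le_of_le_one_left (abs_nonneg _) (Real.abs_sin_le_one _))
      (mul_le_of_le_one_left (abs_nonneg _) (Real.abs_cos_le_one _))

end IsKineticKuramotoSolution

/-! ### Locking at subcritical frequencies -/

lemma tendsto_cos_sin_sub {φ : ℝ → ℝ} {φs : ℝ}
    (hφ : Tendsto (fun t => (φ t : Torus)) atTop (𝓝 (φs : Torus))) :
    Tendsto (fun t => Real.cos (φ t - φs)) atTop (𝓝 1) ∧
      Tendsto (fun t => Real.sin (φ t - φs)) atTop (𝓝 0) := by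
  have h := hφ.sub_const (φs : Torus)
  rw [sub_self, ← AddCircle.coe_zero] at h
  constructor
  · have := (continuous_torusCos.tendsto _).comp h
    rw [torusCos_coe, Real.cos_zero] at this
    refine this.congr fun t => ?_
    rw [Function.comp_apply, ← AddCircle.coe_sub, torusCos_coe]
  · have := (continuous_torusSin.tendsto _).comp h
    rw [torusSin_coe, Real.sin_zero] at this
    refine this.congr fun t => ?_
    rw [Function.comp_apply, ← AddCircle.coe_sub, torusSin_coe]

lemma tendsto_drift_error {K Rs φs : ℝ} {R φ : ℝ → ℝ} (hR : Tendsto R atTop (𝓝 Rs))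
    (hφ : Tendsto (fun t => (φ t : Torus)) atTop (𝓝 (φs : Torus))) :
    Tendsto (fun t => K * (|R t * Real.cos (φ t - φs) - Rs| + |R t * Real.sin (φ t - φs)|))
      atTop (𝓝 0) := by
  obtain ⟨h1, h2⟩ := tendsto_cos_sin_sub hφ
  have := ((((hR.mul h1).sub_const Rs).abs).add ((hR.mul h2).abs)).const_mul K
  simpa using this

lemma tendsto_sin_zero_of_cos {ι : Type*} {l : Filter ι} {y : ι → ℝ} {c : ℝ} (hc : c ^ 2 = 1)
    (h : Tendsto (fun i => Real.cos (y i)) l (𝓝 c)) :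
    Tendsto (fun i => Real.sin (y i)) l (𝓝 0) := by
  have h1 : Tendsto (fun i => Real.sin (y i) ^ 2) l (𝓝 0) := by
    simp_rw [Real.sin_sq]
    simpa [hc] using (h.pow 2).const_sub 1
  rw [tendsto_zero_iff_abs_tendsto_zero]
  simpa [Real.sqrt_sq_eq_abs, Function.comp_def] using h1.sqrt

/-- The phase of the locked state at frequency `ω`. -/
noncomputable def lockedPhase (K Rs φs ω : ℝ) : Torus :=
  ((φs + Real.arcsin (ω / (K * Rs)) : ℝ) : Torus)

lemma continuous_lockedPhase (K Rs φs : ℝ) : Continuous (lockedPhase K Rs φs) :=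
  (AddCircle.continuous_mk' _).comp
    (continuous_const.add (Real.continuous_arcsin.comp (continuous_id.div_const _)))

namespace IsKineticKuramotoSolution

variable {K : ℝ} {f : ℝ → ProbabilityMeasure PhaseSpace} {Θ : ℝ → Torus → ℝ → Torus}
  {R φ : ℝ → ℝ}

lemma torusCos_sub_lockedPhase {Rs φs ω x : ℝ} {z : Torus} (h : (x : Torus) = z - (φs : Torus)) :
    torusCos (z - lockedPhase K Rs φs ω) = Real.cos (x - Real.arcsin (ω / (K * Rs))) := by
  rw [← torusCos_coe, AddCircle.coe_sub, h, lockedPhase, AddCircle.coe_add, sub_sub]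

/-- Away from the critical frequencies a characteristic either locks or approaches the
unstable rest point. -/
lemma tendsto_locked_or_unstable (hsol : IsKineticKuramotoSolution K f Θ R φ) (hK : 0 < K)
    {Rs φs : ℝ} (hRs : 0 < Rs) (hR : Tendsto R atTop (𝓝 Rs))
    (hφ : Tendsto (fun t => (φ t : Torus)) atTop (𝓝 (φs : Torus))) (ϑ : Torus) {ω : ℝ}
    (hω : |ω| < K * Rs) :
    Tendsto (fun t => torusCos (Θ t ϑ ω - lockedPhase K Rs φs ω)) atTop (𝓝 1) ∨
      ∃ x : ℝ → ℝ, (∀ t, 0 ≤ t → (x t : Torus) = Θ t ϑ ω - (φs : Torus)) ∧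
        (∀ t, 0 ≤ t → HasDerivWithinAt x (ω - K * R t * Real.sin (x t - (φ t - φs)))
          (Set.Ici 0) t) ∧
        Tendsto (fun t => Real.cos (x t + Real.arcsin (ω / (K * Rs)))) atTop (𝓝 (-1)) := by
  obtain ⟨x, e, hx, hd, hde, he⟩ := hsol.exists_lift hK Rs φs ϑ ω
  have hκ : 0 < K * Rs := mul_pos hK hRs
  have hlt : |ω / (K * Rs)| < 1 := by
    rw [abs_div, abs_of_pos hκ, div_lt_one hκ]; exact hω
  obtain ⟨h1, h2⟩ := abs_lt.1 hlt
  have hcos : 0 < Real.cos (Real.arcsin (ω / (K * Rs))) := by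
    rw [Real.cos_arcsin]
    apply Real.sqrt_pos.2
    nlinarith
  have hsin : K * Rs * Real.sin (Real.arcsin (ω / (K * Rs))) = ω := by
    rw [Real.sin_arcsin h1.le h2.le, mul_div_cancel₀ _ hκ.ne']
  have he0 : Tendsto e atTop (𝓝 0) :=
    squeeze_zero_norm he (tendsto_drift_error hR hφ)
  rcases cos_sub_tendsto_one_or_cos_add_tendsto_neg_one hκ hcos (x := x) (e := e)
    (fun t ht => by
      rw [mul_sub, hsin, ← hde]
      exact hd t ht) he0 with H | H
  · left
    refine H.congr' ?_
    filter_upwards [eventually_ge_atTop 0] with t ht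
    rw [torusCos_sub_lockedPhase (hx t ht)]
  · exact Or.inr ⟨x, hx, hd, H⟩

/-- At a subcritical frequency at most one initial phase fails to lock. -/
lemma eq_of_not_tendsto_locked (hsol : IsKineticKuramotoSolution K f Θ R φ) (hK : 0 < K)
    {Rs φs : ℝ} (hRs : 0 < Rs) (hR : Tendsto R atTop (𝓝 Rs))
    (hφ : Tendsto (fun t => (φ t : Torus)) atTop (𝓝 (φs : Torus))) {ϑ ϑ' : Torus} {ω : ℝ}
    (hω : |ω| < K * Rs)
    (h : ¬ Tendsto (fun t => torusCos (Θ t ϑ ω - lockedPhase K Rs φs ω)) atTop (𝓝 1))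
    (h' : ¬ Tendsto (fun t => torusCos (Θ t ϑ' ω - lockedPhase K Rs φs ω)) atTop (𝓝 1)) :
    ϑ = ϑ' := by
  obtain ⟨x, hx, hxd, hxl⟩ := (hsol.tendsto_locked_or_unstable hK hRs hR hφ ϑ hω).resolve_left h
  obtain ⟨y, hy, hyd, hyl⟩ :=
    (hsol.tendsto_locked_or_unstable hK hRs hR hφ ϑ' hω).resolve_left h'
  have hκ : 0 < K * Rs := mul_pos hK hRs
  have hcos : 0 < Real.cos (Real.arcsin (ω / (K * Rs))) := by
    have hlt : |ω / (K * Rs)| < 1 := by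
      rw [abs_div, abs_of_pos hκ, div_lt_one hκ]; exact hω
    obtain ⟨h1, h2⟩ := abs_lt.1 hlt
    rw [Real.cos_arcsin]
    apply Real.sqrt_pos.2
    nlinarith
  set a := Real.arcsin (ω / (K * Rs)) with ha
  obtain ⟨hdc, hds⟩ := tendsto_cos_sin_sub hφ
  -- At the unstable point `π - a` the cosine is `-cos a < 0`, and the moving phase `φ t - φs` is
  -- asymptotically negligible.
  have hrep : ∀ z : ℝ → ℝ, Tendsto (fun t => Real.cos (z t + a)) atTop (𝓝 (-1)) →
      ∀ᶠ t in atTop, Real.cos (z t - (φ t - φs)) ≤ 0 := by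
    intro z hz
    have hzs := tendsto_sin_zero_of_cos (by norm_num) hz
    have h1 : Tendsto (fun t => Real.cos (z t)) atTop (𝓝 (-Real.cos a)) := by
      have := (hz.mul_const (Real.cos a)).add (hzs.mul_const (Real.sin a))
      simp only [neg_mul, one_mul, zero_mul, add_zero] at this
      refine this.congr fun t => ?_
      rw [← Real.cos_sub, add_sub_cancel_right]
    have h2 : Tendsto (fun t => Real.sin (z t) * Real.sin (φ t - φs)) atTop (𝓝 0) :=
      bdd_le_mul_tendsto_zero' 1 (Eventually.of_forall fun t => Real.abs_sin_le_one _) hds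
    have h3 := (h1.mul hdc).add h2
    simp only [mul_one, add_zero] at h3
    filter_upwards [h3.eventually (Iio_mem_nhds (show -Real.cos a < 0 by linarith))] with t ht
    rw [Real.cos_sub]
    exact le_of_lt ht
  have hxy : Tendsto (fun t => Real.cos (x t - y t)) atTop (𝓝 1) := by
    have h1 := (hxl.mul hyl).add ((tendsto_sin_zero_of_cos (by norm_num) hxl).mul
      (tendsto_sin_zero_of_cos (by norm_num) hyl))
    norm_num at h1
    refine h1.congr fun t => ?_
    rw [← Real.cos_sub, add_sub_add_right_eq_sub]
  have h0 := cos_sub_eq_one_of_repelling (k := fun t => K * R t) (φ := fun t => φ t - φs)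
    (K := K) (fun t ht => ⟨mul_nonneg hK.le (hsol.R_nonneg t ht), by
      nlinarith [hsol.R_le_one ht]⟩) hxd hyd (hrep x hxl) (hrep y hyl) hxy
  have h1 := torus_eq_of_cos_sub_eq_one h0
  rw [hx 0 le_rfl, hy 0 le_rfl, hsol.init, hsol.init] at h1
  exact sub_left_injective h1

lemma continuous_torusCos_sub_lockedPhase (hsol : IsKineticKuramotoSolution K f Θ R φ)
    (hK : 0 < K) (Rs φs : ℝ) {t : ℝ} (ht : 0 ≤ t) :
    Continuous fun p : PhaseSpace => torusCos (Θ t p.1 p.2 - lockedPhase K Rs φs p.2) :=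
  continuous_torusCos.comp ((hsol.continuous_char hK ht).sub
    ((continuous_lockedPhase K Rs φs).comp continuous_snd))

/-- Almost every characteristic with a subcritical frequency locks. -/
lemma ae_tendsto_locked (hsol : IsKineticKuramotoSolution K f Θ R φ) (hK : 0 < K)
    (hna : ∀ᵐ ω ∂(freqLaw (f 0)), NullSingletonClass (condPhase (f 0) ω))
    {Rs φs : ℝ} (hRs : 0 < Rs) (hR : Tendsto R atTop (𝓝 Rs))
    (hφ : Tendsto (fun t => (φ t : Torus)) atTop (𝓝 (φs : Torus))) :
    ∀ᵐ p ∂(f 0 : Measure PhaseSpace), |p.2| < K * Rs →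
      Tendsto (fun t => torusCos (Θ t p.1 p.2 - lockedPhase K Rs φs p.2)) atTop (𝓝 1) := by
  have hκ : 0 < K * Rs := mul_pos hK hRs
  -- Integer times make the set of locking labels visibly measurable; the dichotomy recovers real
  -- times afterwards.
  set G : Set PhaseSpace := {p | Tendsto (fun n : ℕ =>
    torusCos (Θ (n : ℝ) p.1 p.2 - lockedPhase K Rs φs p.2)) atTop (𝓝 1)} with hG
  have hGm : MeasurableSet G := measurableSet_tendsto (𝓝 1) fun n =>
    (hsol.continuous_torusCos_sub_lockedPhase hK Rs φs n.cast_nonneg).measurable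
  have hIm : MeasurableSet {p : PhaseSpace | |p.2| < K * Rs} :=
    measurableSet_lt (by fun_prop) measurable_const
  have hnull : (f 0 : Measure PhaseSpace) ({p : PhaseSpace | |p.2| < K * Rs} ∩ Gᶜ) = 0 := by
    refine measure_eq_zero_of_subsingleton_slices (f 0) hna (hIm.inter hGm.compl) ?_
    rintro ω ϑ ⟨h1, h2⟩ ϑ' ⟨-, h2'⟩
    exact hsol.eq_of_not_tendsto_locked hK hRs hR hφ h1
      (fun h => h2 (h.comp tendsto_natCast_atTop_atTop))
      (fun h => h2' (h.comp tendsto_natCast_atTop_atTop))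
  filter_upwards [measure_eq_zero_iff_ae_notMem.1 hnull] with p hp hpω
  have hpG : p ∈ G := by
    by_contra h
    exact hp ⟨hpω, h⟩
  refine (hsol.tendsto_locked_or_unstable hK hRs hR hφ p.1 hpω).resolve_right ?_
  rintro ⟨x, hx, -, hl⟩
  set a := Real.arcsin (p.2 / (K * Rs)) with ha
  have hsin : |Real.sin a| < 1 := by
    have hlt : |p.2 / (K * Rs)| < 1 := by
      rw [abs_div, abs_of_pos hκ, div_lt_one hκ]; exact hpω
    obtain ⟨h1, h2⟩ := abs_lt.1 hlt
    rw [ha, Real.sin_arcsin h1.le h2.le]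
    exact hlt
  have h1 : Tendsto (fun n : ℕ => Real.cos (x n - a)) atTop (𝓝 1) := by
    refine Tendsto.congr (fun n => ?_) hpG
    rw [torusCos_sub_lockedPhase (hx n n.cast_nonneg)]
  have h2 := h1.sub (hl.comp tendsto_natCast_atTop_atTop)
  -- Locking along integers and approach to the unstable point would give `2 sin x sin a → 2`,
  -- impossible as `|sin a| < 1`.
  have h3 : (1 : ℝ) - -1 ≤ 2 * |Real.sin a| := by
    refine le_of_tendsto' h2 fun n => ?_
    rw [Function.comp_apply, Real.cos_sub, Real.cos_add]
    have h4 : |Real.sin (x n) * Real.sin a| ≤ |Real.sin a| := by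
      rw [abs_mul]
      exact mul_le_of_le_one_left (abs_nonneg _) (Real.abs_sin_le_one _)
    linarith [(abs_le.1 h4).2]
  linarith

/-! ### Mean convergence to the locked phase and weak convergence -/

/-- The order parameter in terms of the characteristics. -/
lemma integral_torusCos_char (hsol : IsKineticKuramotoSolution K f Θ R φ) (ψ : ℝ) {t : ℝ}
    (ht : 0 ≤ t) :
    ∫ p, torusCos (Θ t p.1 p.2 - (ψ : Torus)) ∂(f 0 : Measure PhaseSpace) =
      R t * Real.cos (φ t - ψ) := by
  rw [← hsol.integral_torusCos ψ ht]
  exact (hsol.transport t ht (BoundedContinuousFunction.ofNormedAddCommGroup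
    (fun p : PhaseSpace => torusCos (p.1 - (ψ : Torus)))
    (continuous_torusCos.comp (by fun_prop)) 1 fun p => abs_torusCos_le_one _)).symm

lemma ae_abs_le {μ : ProbabilityMeasure PhaseSpace} {κ : ℝ}
    (hsupp : (freqLaw μ).support ⊆ Set.Icc (-κ) κ) :
    ∀ᵐ p ∂(μ : Measure PhaseSpace), |p.2| ≤ κ := by
  have h : ∀ᵐ ω ∂(freqLaw μ), ω ∈ (freqLaw μ).support := Measure.support_mem_ae
  have h2 : ∀ᵐ p ∂(μ : Measure PhaseSpace), p.2 ∈ (freqLaw μ).support :=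
    ae_of_ae_map measurable_snd.aemeasurable h
  filter_upwards [h2] with p hp
  exact abs_le.2 (hsupp hp)

/-- The mean distance to the locked phase tends to zero. -/
lemma tendsto_integral_one_sub (hsol : IsKineticKuramotoSolution K f Θ R φ) (hK : 0 < K)
    (hna : ∀ᵐ ω ∂(freqLaw (f 0)), NullSingletonClass (condPhase (f 0) ω))
    {Rs φs : ℝ} (hRs : 0 < Rs) (hR : Tendsto R atTop (𝓝 Rs))
    (hφ : Tendsto (fun t => (φ t : Torus)) atTop (𝓝 (φs : Torus)))
    (hsupp : (freqLaw (f 0)).support ⊆ Set.Icc (-(K * Rs)) (K * Rs)) :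
    Tendsto (fun t => ∫ p, (1 - torusCos (Θ t p.1 p.2 - lockedPhase K Rs φs p.2))
      ∂(f 0 : Measure PhaseSpace)) atTop (𝓝 0) := by
  have hκ : 0 < K * Rs := mul_pos hK hRs
  set μ : Measure PhaseSpace := (f 0 : Measure PhaseSpace) with hμ
  set E : Set PhaseSpace := {p | |p.2| = K * Rs} with hE
  have hEm : MeasurableSet E := measurableSet_eq_fun (by fun_prop) measurable_const
  set c : ℝ → PhaseSpace → ℝ := fun t p => torusCos (Θ t p.1 p.2 - (φs : Torus)) with hc
  set P : ℝ → PhaseSpace → ℝ :=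
    fun t p => 1 - torusCos (Θ t p.1 p.2 - lockedPhase K Rs φs p.2) with hP
  have hcc : ∀ t, 0 ≤ t → Continuous (c t) := fun t ht =>
    continuous_torusCos.comp ((hsol.continuous_char hK ht).sub continuous_const)
  have hPc : ∀ t, 0 ≤ t → Continuous (P t) := fun t ht =>
    continuous_const.sub (hsol.continuous_torusCos_sub_lockedPhase hK Rs φs ht)
  have hcb : ∀ t p, ‖c t p‖ ≤ 1 := fun t p => abs_torusCos_le_one _
  have hPb : ∀ t p, ‖P t p‖ ≤ 2 := fun t p => by
    refine (abs_sub _ _).trans ?_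
    rw [abs_one]
    linarith [abs_torusCos_le_one (Θ t p.1 p.2 - lockedPhase K Rs φs p.2)]
  have hcint : ∀ t, 0 ≤ t → Integrable (c t) μ := fun t ht =>
    Integrable.of_bound (hcc t ht).aestronglyMeasurable 1 (Eventually.of_forall (hcb t))
  have hPint : ∀ t, 0 ≤ t → Integrable (P t) μ := fun t ht =>
    Integrable.of_bound (hPc t ht).aestronglyMeasurable 2 (Eventually.of_forall (hPb t))
  have hlock : ∀ᵐ p ∂(μ.restrict Eᶜ), Tendsto (fun t => P t p) atTop (𝓝 0) := by
    rw [ae_restrict_iff' hEm.compl]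
    filter_upwards [hsol.ae_tendsto_locked hK hna hRs hR hφ, ae_abs_le hsupp] with p h1 h2 h3
    simpa using (h1 (lt_of_le_of_ne h2 h3)).const_sub 1
  have hclim : ∀ᵐ p ∂(μ.restrict Eᶜ), Tendsto (fun t => c t p) atTop
      (𝓝 (Real.cos (Real.arcsin (p.2 / (K * Rs))))) := by
    filter_upwards [hlock] with p hp
    have h1 : Tendsto (fun t => torusCos (Θ t p.1 p.2 - lockedPhase K Rs φs p.2)) atTop
        (𝓝 1) := by simpa [hP] using hp.const_sub 1
    have h2 := tendsto_of_tendsto_torusCos_sub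
      (h1.congr fun t => rfl)
    have h3 := (continuous_torusCos.tendsto _).comp (h2.sub_const (φs : Torus))
    rw [lockedPhase, AddCircle.coe_add, add_sub_cancel_left, torusCos_coe] at h3
    exact h3
  have hcEc : Tendsto (fun t => ∫ p in Eᶜ, c t p ∂μ) atTop
      (𝓝 (∫ p in Eᶜ, Real.cos (Real.arcsin (p.2 / (K * Rs))) ∂μ)) := by
    refine tendsto_integral_filter_of_dominated_convergence (fun _ => 1) ?_ ?_
      (integrable_const _) hclim
    · filter_upwards [eventually_ge_atTop 0] with t ht
      exact (hcc t ht).aestronglyMeasurable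
    · exact Eventually.of_forall fun t => Eventually.of_forall (hcb t)
  have hPEc : Tendsto (fun t => ∫ p in Eᶜ, P t p ∂μ) atTop (𝓝 0) := by
    have := tendsto_integral_filter_of_dominated_convergence (μ := μ.restrict Eᶜ)
      (F := P) (f := fun _ => 0) (l := atTop) (fun _ => 2) ?_ ?_ (integrable_const _) hlock
    · simpa using this
    · filter_upwards [eventually_ge_atTop 0] with t ht
      exact (hPc t ht).aestronglyMeasurable
    · exact Eventually.of_forall fun t => Eventually.of_forall (hPb t)
  have hctot : Tendsto (fun t => ∫ p, c t p ∂μ) atTop (𝓝 Rs) := by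
    have h1 := hR.mul (tendsto_cos_sin_sub hφ).1
    rw [mul_one] at h1
    refine h1.congr' ?_
    filter_upwards [eventually_ge_atTop 0] with t ht
    exact (hsol.integral_torusCos_char φs ht).symm
  -- The mean cosine over the critical set converges by subtraction; its limit need not be known.
  have hcE := (hctot.sub hcEc).congr' (f₂ := fun t => ∫ p in E, c t p ∂μ) (by
    filter_upwards [eventually_ge_atTop 0] with t ht
    rw [← integral_add_compl hEm (hcint t ht), add_sub_cancel_right])
  have hmemE : ∀ᵐ p ∂(μ.restrict E), p ∈ E := ae_restrict_mem hEm
  have hcrit : ∀ p ∈ E, (p.2 / (K * Rs)) ^ 2 = 1 ∧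
      Real.sin (Real.arcsin (p.2 / (K * Rs))) = p.2 / (K * Rs) ∧
      Real.cos (Real.arcsin (p.2 / (K * Rs))) = 0 := by
    intro p hp
    have habs : |p.2 / (K * Rs)| = 1 := by
      rw [abs_div, abs_of_pos hκ, div_eq_one_iff_eq hκ.ne']; exact hp
    have hsq : (p.2 / (K * Rs)) ^ 2 = 1 := by rw [← sq_abs, habs, one_pow]
    obtain ⟨h1, h2⟩ := abs_le.1 habs.le
    refine ⟨hsq, Real.sin_arcsin h1 h2, ?_⟩
    rw [Real.cos_arcsin, hsq, sub_self, Real.sqrt_zero]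
  have hlift : ∀ p ∈ E, ∃ x e : ℝ → ℝ,
      (∀ t, 0 ≤ t → c t p = Real.cos (x t) ∧
        P t p = 1 - p.2 / (K * Rs) * Real.sin (x t)) ∧
      (∀ t, 0 ≤ t → HasDerivWithinAt x
        (K * Rs * (p.2 / (K * Rs) - Real.sin (x t)) + e t) (Set.Ici 0) t) ∧
      ∀ t, |e t| ≤ K * (|R t * Real.cos (φ t - φs) - Rs| + |R t * Real.sin (φ t - φs)|) := by
    intro p hp
    obtain ⟨x, e, hx, hd, hde, he⟩ := hsol.exists_lift hK Rs φs p.1 p.2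
    obtain ⟨h1, h2, h3⟩ := hcrit p hp
    refine ⟨x, e, fun t ht => ⟨?_, ?_⟩, fun t ht => ?_, he⟩
    · simp only [hc]
      rw [← hx t ht, torusCos_coe]
    · simp only [hP]
      rw [torusCos_sub_lockedPhase (hx t ht), Real.cos_sub, h2, h3]
      ring
    · rw [mul_sub, mul_div_cancel₀ _ hκ.ne', ← hde]
      exact hd t ht
  have hPE : Tendsto (fun t => ∫ p in E, P t p ∂μ) atTop (𝓝 0) := by
    refine tendsto_integral_zero_of_critical hκ (c := c)
      (fun t ht => (hcc t ht).aemeasurable) (fun t ht => (hPc t ht).aemeasurable) ?_ ?_ ?_ hcE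
    · refine fun t ht => Eventually.of_forall fun p => ?_
      simp only [hP]
      linarith [(abs_le.1 (abs_torusCos_le_one (Θ t p.1 p.2 - lockedPhase K Rs φs p.2))).2]
    · intro t ht
      filter_upwards [hmemE] with p hp
      obtain ⟨x, e, h1, -, -⟩ := hlift p hp
      rw [(h1 t ht).1, (h1 t ht).2]
      linear_combination Real.sin_sq_add_cos_sq (x t) + (Real.sin (x t)) ^ 2 * (hcrit p hp).1
    · intro N hN ε hε
      set δ := ε / (192 * N ^ 7 * (N / (K * Rs))) with hδ
      have hδ0 : 0 < δ := by positivity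
      obtain ⟨T, hT⟩ := eventually_atTop.1
        (((tendsto_drift_error (K := K) hR hφ).eventually (Iio_mem_nhds hδ0)).and
          (eventually_ge_atTop 0))
      have hT0 : 0 ≤ T := (hT T le_rfl).2
      refine ⟨T, fun τ b hτ hb hs => ?_⟩
      filter_upwards [hmemE] with p hp
      obtain ⟨x, e, h1, h2, h3⟩ := hlift p hp
      rw [(h1 τ (hT0.trans hτ)).1, (h1 τ (hT0.trans hτ)).2, (h1 b (hT0.trans hb)).1]
      refine (abs_translateKer_sub_cos_le (hcrit p hp).1 hN
        (fun t ht => (h2 t (hT0.trans ht)).mono (Set.Ici_subset_Ici.2 hT0))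
        (fun t ht => (h3 t).trans (le_of_lt (hT t ht).1)) hτ hb hs).trans ?_
      have h4 : |b - τ| ≤ N / (K * Rs) := by
        rw [abs_mul, abs_of_pos hκ] at hs
        rw [le_div_iff₀ hκ]; linarith
      calc 192 * N ^ 7 * δ * |b - τ| ≤ 192 * N ^ 7 * δ * (N / (K * Rs)) := by gcongr
        _ = ε := by rw [hδ]; field_simp
  have := hPE.add hPEc
  rw [add_zero] at this
  refine this.congr' ?_
  filter_upwards [eventually_ge_atTop 0] with t ht
  exact integral_add_compl hEm (hPint t ht)

/-- Weak convergence to the locked state. -/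
lemma tendsto_lockedState (hsol : IsKineticKuramotoSolution K f Θ R φ) (hK : 0 < K)
    (hna : ∀ᵐ ω ∂(freqLaw (f 0)), NullSingletonClass (condPhase (f 0) ω))
    {Rs φs : ℝ} (hRs : 0 < Rs) (hR : Tendsto R atTop (𝓝 Rs))
    (hφ : Tendsto (fun t => (φ t : Torus)) atTop (𝓝 (φs : Torus)))
    (hsupp : (freqLaw (f 0)).support ⊆ Set.Icc (-(K * Rs)) (K * Rs)) :
    Tendsto f atTop (𝓝 (⟨lockedState K Rs φs (freqLaw (f 0)), inferInstance⟩ :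
      ProbabilityMeasure PhaseSpace)) := by
  refine ProbabilityMeasure.tendsto_iff_forall_integral_tendsto.2 fun h => ?_
  have hlim : ∫ x, h x ∂(lockedState K Rs φs (freqLaw (f 0))) =
      ∫ p, h (lockedPhase K Rs φs p.2, p.2) ∂(f 0 : Measure PhaseSpace) := by
    have hcont : Continuous fun ω : ℝ => ((lockedPhase K Rs φs ω, ω) : PhaseSpace) :=
      (continuous_lockedPhase K Rs φs).prodMk continuous_id
    change ∫ x, h x ∂(((f 0 : Measure PhaseSpace).snd).map
      fun ω : ℝ => ((lockedPhase K Rs φs ω, ω) : PhaseSpace)) = _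
    rw [integral_map hcont.aemeasurable h.continuous.aestronglyMeasurable, Measure.snd]
    exact integral_map measurable_snd.aemeasurable
      (h.continuous.comp hcont).aestronglyMeasurable
  change Tendsto _ atTop (𝓝 (∫ x, h x ∂(lockedState K Rs φs (freqLaw (f 0)))))
  rw [hlim]
  refine tendsto_of_subseq_tendsto fun ns hns => ?_
  -- Clipping at zero keeps every term in the range where the characteristics are controlled; it is
  -- eventually inactive.
  set D : ℕ → PhaseSpace → ℝ := fun n p =>
    1 - torusCos (Θ (max (ns n) 0) p.1 p.2 - lockedPhase K Rs φs p.2) with hD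
  have hDc : ∀ n, Continuous (D n) := fun n =>
    continuous_const.sub
      (hsol.continuous_torusCos_sub_lockedPhase hK Rs φs (le_max_right _ _))
  have hD0 : ∀ n p, 0 ≤ D n p := fun n p => by
    simp only [hD]
    linarith [(abs_le.1 (abs_torusCos_le_one
      (Θ (max (ns n) 0) p.1 p.2 - lockedPhase K Rs φs p.2))).2]
  have hD2 : ∀ n p, ‖D n p‖ ≤ 2 := fun n p => by
    rw [Real.norm_of_nonneg (hD0 n p)]
    simp only [hD]
    linarith [(abs_le.1 (abs_torusCos_le_one
      (Θ (max (ns n) 0) p.1 p.2 - lockedPhase K Rs φs p.2))).1]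
  have hns' : Tendsto (fun n => max (ns n) 0) atTop atTop :=
    tendsto_atTop_mono (fun n => le_max_left _ _) hns
  have hDint : Tendsto (fun n => ∫ p, D n p ∂(f 0 : Measure PhaseSpace)) atTop (𝓝 0) :=
    (hsol.tendsto_integral_one_sub hK hna hRs hR hφ hsupp).comp hns'
  -- Critical labels come with L¹ convergence only, so almost everywhere convergence is extracted
  -- along a further subsequence, which suffices for the limit of the integrals.
  have hmeas : TendstoInMeasure (f 0 : Measure PhaseSpace) D atTop fun _ => 0 := by
    refine tendstoInMeasure_of_tendsto_eLpNorm one_ne_zero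
      (fun n => (hDc n).aestronglyMeasurable) aestronglyMeasurable_const ?_
    have : ∀ n, eLpNorm (D n - fun _ => 0) 1 (f 0 : Measure PhaseSpace) =
        ENNReal.ofReal (∫ p, D n p ∂(f 0 : Measure PhaseSpace)) := fun n => by
      have hi : Integrable (D n) (f 0 : Measure PhaseSpace) :=
        Integrable.of_bound (hDc n).aestronglyMeasurable 2 (Eventually.of_forall (hD2 n))
      have h0 : (D n - fun _ => 0) = D n := by ext p; simp
      rw [h0, eLpNorm_one_eq_lintegral_enorm, ← ofReal_integral_norm_eq_lintegral_enorm hi]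
      congr 1
      exact integral_congr_ae (Eventually.of_forall fun p => Real.norm_of_nonneg (hD0 n p))
    simp_rw [this]
    simpa using ENNReal.tendsto_ofReal hDint
  obtain ⟨ms, hms, hae⟩ := hmeas.exists_seq_tendsto_ae
  refine ⟨ms, ?_⟩
  have hdct : Tendsto (fun n => ∫ p, h (Θ (max (ns (ms n)) 0) p.1 p.2, p.2)
      ∂(f 0 : Measure PhaseSpace)) atTop
      (𝓝 (∫ p, h (lockedPhase K Rs φs p.2, p.2) ∂(f 0 : Measure PhaseSpace))) := by
    refine tendsto_integral_of_dominated_convergence (fun _ => ‖h‖) (fun n => ?_)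
      (integrable_const _) (fun n => Eventually.of_forall fun p => h.norm_coe_le_norm _) ?_
    · exact (h.continuous.comp ((hsol.continuous_char hK (le_max_right _ _)).prodMk
        continuous_snd)).aestronglyMeasurable
    · filter_upwards [hae] with p hp
      have h1 : Tendsto (fun n => torusCos (Θ (max (ns (ms n)) 0) p.1 p.2 -
          lockedPhase K Rs φs p.2)) atTop (𝓝 1) := by
        simpa [hD] using hp.const_sub 1
      exact (h.continuous.tendsto _).comp
        ((tendsto_of_tendsto_torusCos_sub h1).prodMk_nhds tendsto_const_nhds)
  refine hdct.congr' ?_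
  filter_upwards [(hns.comp hms.tendsto_atTop).eventually (eventually_ge_atTop 0)] with n hn
  have hn' : 0 ≤ ns (ms n) := hn
  rw [max_eq_left hn', hsol.transport _ hn']

end IsKineticKuramotoSolution

/-! ### Conclusion and self-consistency -/

theorem proposition4p1 (K : ℝ) (hK : 0 < K)
    (f : ℝ → ProbabilityMeasure PhaseSpace) (Θ : ℝ → Torus → ℝ → Torus) (R φ : ℝ → ℝ)
    (hsol : IsKineticKuramotoSolution K f Θ R φ)
    (hna : ∀ᵐ ω ∂(freqLaw (f 0)), NullSingletonClass (condPhase (f 0) ω))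
    (Rs φs : ℝ) (hRs : 0 < Rs)
    (hR : Tendsto R atTop (𝓝 Rs))
    (hφ : Tendsto (fun t => (φ t : Torus)) atTop (𝓝 (φs : Torus)))
    (hsupp : (freqLaw (f 0)).support ⊆ Set.Icc (-(K * Rs)) (K * Rs)) :
    Tendsto f atTop
        (𝓝 (⟨lockedState K Rs φs (freqLaw (f 0)), inferInstance⟩ :
          ProbabilityMeasure PhaseSpace)) ∧
      K * Rs ^ 2 = ∫ ω, Real.sqrt ((K * Rs) ^ 2 - ω ^ 2) ∂(freqLaw (f 0)) := by
  have hκ : 0 < K * Rs := mul_pos hK hRs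
  have hlim := hsol.tendsto_lockedState hK hna hRs hR hφ hsupp
  refine ⟨hlim, ?_⟩
  -- The real part of the order parameter in the limit frame: its means tend to `Rs`, and also to
  -- its mean in the locked state.
  set h : BoundedContinuousFunction PhaseSpace ℝ :=
    BoundedContinuousFunction.ofNormedAddCommGroup
      (fun p : PhaseSpace => torusCos (p.1 - (φs : Torus)))
      (continuous_torusCos.comp (by fun_prop)) 1 fun p => abs_torusCos_le_one _ with hh
  have h1 := (ProbabilityMeasure.tendsto_iff_forall_integral_tendsto.1 hlim) h
  have h2 : Tendsto (fun t => ∫ p, h p ∂(f t : Measure PhaseSpace)) atTop (𝓝 Rs) := by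
    have := hR.mul (tendsto_cos_sin_sub hφ).1
    rw [mul_one] at this
    refine this.congr' ?_
    filter_upwards [eventually_ge_atTop 0] with t ht
    exact (hsol.integral_torusCos φs ht).symm
  have h3 : Rs = ∫ p, h p ∂(lockedState K Rs φs (freqLaw (f 0))) := tendsto_nhds_unique h2 h1
  have hcont : Continuous fun ω : ℝ => ((lockedPhase K Rs φs ω, ω) : PhaseSpace) :=
    (continuous_lockedPhase K Rs φs).prodMk continuous_id
  have h4 : ∫ p, h p ∂(lockedState K Rs φs (freqLaw (f 0))) =
      ∫ ω, Real.cos (Real.arcsin (ω / (K * Rs))) ∂(freqLaw (f 0)) := by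
    change ∫ x, h x ∂((freqLaw (f 0)).map
      fun ω : ℝ => ((lockedPhase K Rs φs ω, ω) : PhaseSpace)) = _
    rw [integral_map hcont.aemeasurable h.continuous.aestronglyMeasurable]
    refine integral_congr_ae (Eventually.of_forall fun ω => ?_)
    change torusCos (lockedPhase K Rs φs ω - (φs : Torus)) = _
    rw [lockedPhase, AddCircle.coe_add, add_sub_cancel_left, torusCos_coe]
  calc K * Rs ^ 2 = K * Rs * ∫ ω, Real.cos (Real.arcsin (ω / (K * Rs))) ∂(freqLaw (f 0)) := by
        rw [← h4, ← h3]; ring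
    _ = ∫ ω, K * Rs * Real.cos (Real.arcsin (ω / (K * Rs))) ∂(freqLaw (f 0)) :=
        (integral_const_mul _ _).symm
    _ = _ := by
        refine integral_congr_ae (Eventually.of_forall fun ω => ?_)
        change K * Rs * Real.cos (Real.arcsin (ω / (K * Rs))) = √((K * Rs) ^ 2 - ω ^ 2)
        have e1 : (K * Rs) ^ 2 - ω ^ 2 = (K * Rs) ^ 2 * (1 - (ω / (K * Rs)) ^ 2) := by
          field_simp
        rw [Real.cos_arcsin, e1, Real.sqrt_mul (sq_nonneg _), Real.sqrt_sq hκ.le]
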